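/- Let $(X,\mu)$ be a standard probability space without atoms and let $\mathrm{Aut}(X,\mu)$ be the group of bimeasurable measure-preserving bijections of $X$, two of them being identified when they agree almost everywhere. For $T\in\mathrm{Aut}(X,\mu)$ the full group $[T]$ is the set of $U\in\mathrm{Aut}(X,\mu)$ such that for almost every $x$ there is $k\in\mathbb Z$ with $U(x)=T^k(x)$; if $T$ is aperiodic (almost every $T$-orbit is infinite), the $T$-cocycle of $U\in[T]$ is the a.e. unique measurable $c\colon X\to\mathbb Z$ with $U(x)=T^{c(x)}(x)$ for almost every $x$. For $\varphi\colon\mathbb R_+\to\mathbb R_+$, a measurable $c\colon X\to\mathbb Z$ is $\varphi$-integrable if $\int_X\varphi(|c(x)|)\,d\mu<+\infty$. Two aperiodic $T_1,T_2\in\mathrm{Aut}(X,\mu)$ are $\varphi$-integrable orbit equivalent if there is $S\in\mathrm{Aut}(X,\mu)$ such that $ST_1S^{-1}$ and $T_2$ have the same orbits (at almost every point) and both the $T_2$-cocycle of $ST_1S^{-1}$ and the $ST_1S^{-1}$-cocycle of $T_2$ are $\varphi$-integrable. They are flip-conjugate if $T_1$ or $T_1^{-1}$ is conjugate to $T_2$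 in $\mathrm{Aut}(X,\mu)$. Let $\varphi\colon\mathbb R_+\to\mathbb R_+$ be any sublinear function, i.e. $\lim_{t\to+\infty}\varphi(t)/t=0$, and let $T\in\mathrm{Aut}(X,\mu)$ be ergodic. 1. For every integer $n\ge 2$ there are $P\in[T]$ with $\varphi$-integrable $T$-cocycle such that almost every $P$-orbit has exactly $n$ elements, and a measurable set $D\subseteq X$ meeting almost every $P$-orbit in exactly one point, such that $U:=T_D P\in\mathrm{Aut}(X,\mu)$ is $\varphi$-integrable orbit equivalent to $T$ and $U^n$ is not ergodic. Here $T_D$ is the first return map: $T_D(x)=T^{m}(x)$ with $m=\min\{m\ge1: T^m(x)\in D\}$ for $x\in D$, and $T_D(x)=x$ for $x\notin D$. 2. If $T^n$ is ergodic for some integer $n\ge 2$, then there is an ergodic $U\in\mathrm{Aut}(X,\mu)$ such that $T$ and $U$ are $\varphi$-integrable orbit equivalent but not flip-conjugate. -/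

import Mathlib

open MeasureTheory Filter Topology
open scoped NNReal ENNReal

namespace QuantOE

variable {X : Type*} [MeasurableSpace X]

/-- The group of bimeasurable measure-preserving bijections of `(X, μ)`. Two of them count as the
same transformation when they coincide on a conull set, so all notions below are stated almost
everywhere. -/
def Aut (μ : Measure X) : Subgroup (Equiv.Perm X) where
  carrier := {f | MeasurePreserving f μ μ ∧ Measurable f.symm}
  mul_mem' := fun hf hg => ⟨hf.1.comp hg.1, hg.2.comp hf.2⟩
  one_mem' := ⟨MeasurePreserving.id μ, measurable_id⟩
  inv_mem' := fun {f} hf =>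
    ⟨MeasurePreserving.symm ⟨f, hf.1.measurable, hf.2⟩ hf.1, hf.1.measurable⟩

instance (μ : Measure X) : CoeFun (Aut μ) (fun _ => X → X) := ⟨fun T => (T : Equiv.Perm X)⟩

variable {μ : Measure X}

/-- The orbit `{T ^ k x | k ∈ ℤ}`. -/
def orbit (T : Aut μ) (x : X) : Set X := Set.range fun k : ℤ => (T ^ k) x

/-- Almost every orbit is infinite. -/
def Aperiodic (T : Aut μ) : Prop := ∀ᵐ x ∂μ, (orbit T x).Infinite

/-- Almost every orbit is finite. -/
def Periodic (T : Aut μ) : Prop := ∀ᵐ x ∂μ, (orbit T x).Finite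

/-- A periodic transformation whose orbits have cardinality `1` or `n`. -/
def IsNCycle (n : ℕ) (P : Aut μ) : Prop :=
  Periodic P ∧ ∀ᵐ x ∂μ, (orbit P x).ncard = 1 ∨ (orbit P x).ncard = n

/-- The support `{x | T x ≠ x}` is all of `X`, up to a null set. -/
def HasFullSupport (T : Aut μ) : Prop := ∀ᵐ x ∂μ, T x ≠ x

/-- A measurable set which meets almost every orbit in exactly one point. -/
def IsFundamentalDomain (P : Aut μ) (D : Set X) : Prop :=
  MeasurableSet D ∧ ∀ᵐ x ∂μ, ∃! y, y ∈ orbit P x ∩ D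

/-- `U` belongs to the full group `[T]`. -/
def MemFullGroup (T U : Aut μ) : Prop := ∀ᵐ x ∂μ, ∃ k : ℤ, U x = (T ^ k) x

/-- Almost every point has the same orbit under `T` and under `U`. -/
def SameOrbits (T U : Aut μ) : Prop := ∀ᵐ x ∂μ, orbit T x = orbit U x

/-- `c` is a measurable version of the `T`-cocycle of `U`, i.e. `U x = T ^ (c x) x` for almost every
`x`. It is unique up to null sets when `T` is aperiodic. -/
def IsCocycle (T U : Aut μ) (c : X → ℤ) : Prop :=
  Measurable c ∧ ∀ᵐ x ∂μ, U x = (T ^ c x) x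

/-- `∫ φ(|c|) dμ < ∞`. -/
def PhiIntegrable (μ : Measure X) (φ : ℝ≥0 → ℝ≥0) (c : X → ℤ) : Prop :=
  ∫⁻ x, (φ ((c x).natAbs : ℝ≥0) : ℝ≥0∞) ∂μ < ∞

/-- The `T`-cocycle of `U` exists and is `φ`-integrable. -/
def HasPhiIntegrableCocycle (φ : ℝ≥0 → ℝ≥0) (T U : Aut μ) : Prop :=
  ∃ c : X → ℤ, IsCocycle T U c ∧ PhiIntegrable μ φ c

/-- `φ`-integrable orbit equivalence of two aperiodic transformations: some conjugate of `T₁` has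
the same orbits as `T₂`, and both cocycles are `φ`-integrable. -/
def PhiIntegrableOE (φ : ℝ≥0 → ℝ≥0) (T₁ T₂ : Aut μ) : Prop :=
  Aperiodic T₁ ∧ Aperiodic T₂ ∧ ∃ S : Aut μ,
    SameOrbits (S * T₁ * S⁻¹) T₂ ∧
    HasPhiIntegrableCocycle φ T₂ (S * T₁ * S⁻¹) ∧
    HasPhiIntegrableCocycle φ (S * T₁ * S⁻¹) T₂

/-- `T₁` and `T₂` are conjugate in the group of transformations modulo null sets. -/
def Conjugate (T₁ T₂ : Aut μ) : Prop := ∃ S : Aut μ, ∀ᵐ x ∂μ, (S * T₁ * S⁻¹) x = T₂ x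

/-- `T₁` or its inverse is conjugate to `T₂`. -/
def FlipConjugate (T₁ T₂ : Aut μ) : Prop := Conjugate T₁ T₂ ∨ Conjugate T₁⁻¹ T₂

/-- The first return time `min {m ≥ 1 | T ^ m x ∈ D}` (relevant for `x ∈ D`; almost every such point
returns to `D` when `μ` is finite). -/
noncomputable def returnTime (T : Aut μ) (D : Set X) (x : X) : ℕ :=
  sInf {m : ℕ | 1 ≤ m ∧ (T ^ m) x ∈ D}

open Classical in
/-- The first return map `T_D`: it is `x ↦ T ^ (returnTime x) x` on `D` and the identity off `D`. -/
noncomputable def firstReturn (T : Aut μ) (D : Set X) (x : X) : X :=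
  if x ∈ D then (T ^ returnTime T D x) x else x

/-- `φ(t) / t → 0` as `t → +∞`. -/
def Sublinear (φ : ℝ≥0 → ℝ≥0) : Prop := Tendsto (fun t => φ t / t) atTop (𝓝 0)

end QuantOE

/-! The transformation `U = T_D P` runs through a `P`-cycle from its point in `D`, and on closing
the cycle applies `T_D`. So `U ^ n` coincides with `T_D` on `D` (`induced_mul_pow_card_apply`): it
preserves `D`, which is neither null nor conull, and is not ergodic. Since ergodicity of the `n`-th
power is invariant under flip-conjugacy, the second claim follows from the first.

The quantitative work is to choose `P` with integrable displacement (`exists_orbit_partition`).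
First `φ` is dominated on the integers by a monotone subadditive `ψ` with `ψ t ≤ c_k + 2^{-k} t` for
every `k`. Rokhlin towers of height `n` are built successively, the `k`-th one for the map induced
on the part `A k` left uncovered. By Kac's inequality the total length of `n` successive returns to
`A k` has integral at most `n`, so the base `C k` contributes at most `c_k μ(C k) + n 2^{-k}`. The
leftover parts are made so small that the first term is of order `2^{-k}` too, and the sum
converges. The cycles of `P` are the columns of these towers.

For the orbit equivalence, `U` costs one step of `P` and one return to `D`. Conversely, a point is
joined to its image under `T` by going back to the base of its cycle, moving inside `D` by a power
of `T_D`, and climbing the other cycle. A power of `T_D` is never longer than the power of `T` it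
replaces, so subadditivity of `ψ` gives integrability. -/

namespace QuantOE

/-! ### Iterates, measurable choices and full groups -/

variable {X : Type*} [MeasurableSpace X] {μ : Measure X}

theorem zpow_add_apply (T : Aut μ) (a b : ℤ) (x : X) :
    (T ^ (a + b)) x = (T ^ a) ((T ^ b) x) := by
  rw [zpow_add]; rfl

theorem zpow_neg_apply_zpow (T : Aut μ) (a : ℤ) (x : X) : (T ^ (-a)) ((T ^ a) x) = x := by
  rw [← zpow_add_apply]; simp

theorem zpow_apply_zpow_neg (T : Aut μ) (a : ℤ) (x : X) : (T ^ a) ((T ^ (-a)) x) = x := by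
  rw [← zpow_add_apply]; simp

theorem zpow_natCast_apply (T : Aut μ) (m : ℕ) (x : X) : (T ^ (m : ℤ)) x = (T ^ m) x := by
  rw [zpow_natCast]

theorem measurePreserving_coe (T : Aut μ) : MeasurePreserving T μ μ := T.2.1

theorem measurable_coe (T : Aut μ) : Measurable T := T.2.1.measurable

theorem injective_coe (T : Aut μ) : Function.Injective T := (T : Equiv.Perm X).injective

theorem iterate_eq_pow (T : Aut μ) (m : ℕ) : (T : X → X)^[m] = (T ^ m : Aut μ) := by
  have := Equiv.Perm.iterate_eq_pow (T : Equiv.Perm X) m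
  rw [this]; rfl

/-- An element of `Aut μ` as a measurable equivalence. -/
def toMeasurableEquiv (T : Aut μ) : X ≃ᵐ X := ⟨T, T.2.1.measurable, T.2.2⟩

theorem measurableEmbedding_coe (T : Aut μ) : MeasurableEmbedding T :=
  (toMeasurableEquiv T).measurableEmbedding

theorem measure_image (T : Aut μ) (s : Set X) : μ (T '' s) = μ s := by
  have := (measurePreserving_coe T).measure_preimage_emb (measurableEmbedding_coe T) (T '' s)
  rwa [Set.preimage_image_eq _ (injective_coe T), eq_comm] at this

theorem measurableSet_image (T : Aut μ) {s : Set X} (hs : MeasurableSet s) :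
    MeasurableSet (T '' s) :=
  (measurableEmbedding_coe T).measurableSet_image.2 hs

theorem ae_forall_zpow (T : Aut μ) {p : X → Prop} (h : ∀ᵐ x ∂μ, p x) :
    ∀ᵐ x ∂μ, ∀ k : ℤ, p ((T ^ k) x) := by
  rw [ae_all_iff]
  exact fun k => (measurePreserving_coe (T ^ k)).quasiMeasurePreserving.ae h

theorem measurable_pow_apply (T : Aut μ) {c : X → ℕ} (hc : Measurable c) :
    Measurable fun x => (T ^ c x) x := by
  have : Measurable fun p : ℕ × X => (T ^ p.1) p.2 :=
    measurable_from_prod_countable_right fun k => measurable_coe (T ^ k)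
  exact this.comp (hc.prodMk measurable_id)

/-- A choice, among the integers `k` with `p k`, of one with the least absolute value. -/
theorem exists_measurable_int_choice (p : X → ℤ → Prop)
    (hp : ∀ k, MeasurableSet {x | p x k}) :
    ∃ c : X → ℤ, Measurable c ∧ ∀ x k, p x k → p x (c x) ∧ (c x).natAbs ≤ k.natAbs := by
  classical
  have hq : ∀ m : ℕ, MeasurableSet {x | p x m ∨ p x (-m)} := fun m => (hp _).union (hp _)
  -- The last clause makes the search terminate at points where no integer works.
  let q : X → ℕ → Prop := fun x m => (p x m ∨ p x (-m)) ∨ ∀ k, ¬ p x k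
  have hqm : ∀ m, MeasurableSet {x | q x m} := fun m => by
    refine (hq m).union (s₂ := {x | ∀ k, ¬ p x k}) ?_
    rw [Set.ofPred_forall]
    exact MeasurableSet.iInter fun k => (hp k).compl
  have hqe : ∀ x, ∃ m, q x m := fun x => by
    by_cases h : ∃ k, p x k
    · obtain ⟨k, hk⟩ := h
      refine ⟨k.natAbs, Or.inl ?_⟩
      rcases Int.natAbs_eq k with h | h
      · left; rwa [← h]
      · right; rwa [← h]
    · exact ⟨0, Or.inr (not_exists.1 h)⟩
  have hd : Measurable fun x => Nat.find (hqe x) := measurable_find hqe hqm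
  let d := fun x => Nat.find (hqe x)
  have hpd : MeasurableSet {x | p x (d x)} := by
    have : {x | p x (d x)} = ⋃ m : ℕ, {x | p x m} ∩ d ⁻¹' {m} := by
      ext x; simp
    rw [this]
    exact MeasurableSet.iUnion fun m => (hp m).inter (hd (measurableSet_singleton m))
  refine ⟨fun x => if p x (d x) then d x else - d x, ?_, ?_⟩
  · have hd' : Measurable fun x => (d x : ℤ) :=
      (measurable_from_top (f := ((↑) : ℕ → ℤ))).comp hd
    exact Measurable.ite hpd hd' hd'.neg
  · intro x k hk
    have h1 : q x (d x) := Nat.find_spec (hqe x)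
    have h2 : d x ≤ k.natAbs := Nat.find_min' (hqe x) (by
      left
      rcases Int.natAbs_eq k with h | h
      · left; rwa [← h]
      · right; rwa [← h])
    rcases h1 with h1 | h1
    · dsimp only
      split_ifs with h
      · exact ⟨h, by simpa using h2⟩
      · exact ⟨h1.resolve_left h, by simpa using h2⟩
    · exact absurd hk (h1 k)

/-- A bimeasurable bijection which preserves every `T`-orbit preserves the measure. -/
theorem mem_aut_of_forall_zpow [StandardBorelSpace X] (T : Aut μ) (S : Equiv.Perm X)
    (hS : Measurable S) (h : ∀ x, ∃ k : ℤ, S x = (T ^ k) x) : S ∈ Aut μ := by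
  obtain ⟨c, hc, hcS⟩ := exists_measurable_int_choice (fun x k => S x = (T ^ k) x)
    fun k => measurableSet_eq_fun hS (measurable_coe _)
  have hc' : ∀ x, S x = (T ^ c x) x := fun x => (hcS x _ (h x).choose_spec).1
  -- Lusin–Souslin: an injective measurable map of a standard Borel space has measurable images.
  have hemb : MeasurableEmbedding S := hS.measurableEmbedding S.injective
  refine ⟨⟨hS, ?_⟩, (MeasurableEquiv.mk S hS ?_).symm.measurable⟩
  · ext A hA
    rw [Measure.map_apply hS hA]
    let E : ℤ → Set X := fun k => S ⁻¹' A ∩ c ⁻¹' {k}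
    have hE : ∀ k, MeasurableSet (E k) := fun k =>
      (hS hA).inter (hc (measurableSet_singleton k))
    have hdis : Pairwise (Function.onFun Disjoint E) := fun i j hij =>
      Set.disjoint_left.2 fun x hi hj => hij (hi.2.symm.trans hj.2)
    have himg : ∀ k, (T ^ k : Aut μ) '' E k = S '' E k := fun k =>
      Set.image_congr fun x hx => by rw [hc' x, show c x = k from hx.2]
    calc μ (S ⁻¹' A) = μ (⋃ k, E k) := by
          congr 1; ext x; simp [E]
      _ = ∑' k, μ (E k) := measure_iUnion hdis hE
      _ = ∑' k, μ (S '' E k) := by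
          congr 1; ext k; rw [← himg, measure_image]
      _ = μ (⋃ k, S '' E k) := by
          refine (measure_iUnion (fun i j hij => ?_) fun k => hemb.measurableSet_image.2 (hE k)).symm
          exact (Set.disjoint_image_iff S.injective).2 (hdis hij)
      _ = μ A := by
          rw [← Set.image_iUnion]
          congr 1
          rw [show (⋃ k, E k) = S ⁻¹' A by ext x; simp [E]]
          exact Set.image_preimage_eq _ S.surjective
  · intro A hA
    rw [← S.image_eq_preimage_symm]
    exact hemb.measurableSet_image.2 hA

/-- Minimality lets a pointwise bound on any admissible exponent pass to the cocycle, without appeal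
to uniqueness. -/
theorem exists_isCocycle [StandardBorelSpace X] (T U : Aut μ) (h : MemFullGroup T U) :
    ∃ c : X → ℤ, IsCocycle T U c ∧ ∀ x (k : ℤ), U x = (T ^ k) x → (c x).natAbs ≤ k.natAbs := by
  obtain ⟨c, hc, hcS⟩ := exists_measurable_int_choice (fun x (k : ℤ) => U x = (T ^ k) x)
    fun k => measurableSet_eq_fun (measurable_coe U) (measurable_coe _)
  refine ⟨c, ⟨hc, ?_⟩, fun x k hk => (hcS x k hk).2⟩
  filter_upwards [h] with x ⟨k, hk⟩ using (hcS x k hk).1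

theorem sameOrbits_of_memFullGroup {T U : Aut μ} (h₁ : MemFullGroup T U) (h₂ : MemFullGroup U T) :
    SameOrbits T U := by
  have key : ∀ {T U : Aut μ}, MemFullGroup T U → ∀ᵐ x ∂μ, orbit U x ⊆ orbit T x := by
    intro T U h
    filter_upwards [ae_forall_zpow U h] with x hx
    rintro _ ⟨k, rfl⟩
    induction k with
    | zero => exact ⟨0, by simp⟩
    | succ k ih =>
      obtain ⟨l, hl⟩ := ih
      obtain ⟨m, hm⟩ := hx k
      refine ⟨m + l, ?_⟩
      dsimp only at hl ⊢
      rw [add_comm (k : ℤ), zpow_add_apply U, zpow_one, hm, zpow_add_apply, hl]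
    | pred k ih =>
      obtain ⟨l, hl⟩ := ih
      obtain ⟨m, hm⟩ := hx (-k - 1)
      refine ⟨-m + l, ?_⟩
      dsimp only at hl ⊢
      rw [zpow_add_apply, hl]
      have : (U ^ (-k : ℤ)) x = U ((U ^ (-k - 1 : ℤ)) x) := by
        rw [show (-k : ℤ) = 1 + (-k - 1) by ring, zpow_add_apply, zpow_one]
        simp
      rw [this, hm, zpow_neg_apply_zpow]
  filter_upwards [key h₁, key h₂] with x a b using b.antisymm a

/-! ### Small sets, ergodicity and aperiodicity -/

/-- Some point of `A` has only neighbourhoods meeting `A` in positive measure; as it is not an atom,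
outer regularity provides a small one. -/
theorem exists_subset_measure_lt [StandardBorelSpace X] [IsFiniteMeasure μ]
    [NullSingletonClass μ] {A : Set X} (hA : MeasurableSet A) (h0 : μ A ≠ 0) {ε : ℝ≥0∞}
    (hε : ε ≠ 0) : ∃ B ⊆ A, MeasurableSet B ∧ μ B ≠ 0 ∧ μ B < ε := by
  let _ := upgradeStandardBorel X
  obtain ⟨x, -, hx⟩ := exists_mem_forall_mem_nhdsWithin_pos_measure h0
  obtain ⟨V, hxV, hV, hVε⟩ := Set.exists_isOpen_lt_of_lt {x} ε
    (by simpa [measure_singleton] using hε.bot_lt : μ {x} < ε)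
  refine ⟨A ∩ V, Set.inter_subset_left, hA.inter hV.measurableSet, ?_, ?_⟩
  · exact (hx _ (inter_mem_nhdsWithin _ (hV.mem_nhds (hxV rfl)))).ne'
  · exact (measure_mono Set.inter_subset_right).trans_lt hVε

theorem ae_mem_of_measurableSet_invariant {T : Aut μ} (hT : Ergodic T μ) {s : Set X}
    (hs : MeasurableSet s) (h : ∀ x ∈ s, T x ∈ s) [IsFiniteMeasure μ] (h0 : μ s ≠ 0) :
    ∀ᵐ x ∂μ, x ∈ s := by
  rcases hT.ae_empty_or_univ_of_ae_le_preimage hs.nullMeasurableSet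
    (Eventually.of_forall h) with h | h
  · exact absurd (by rw [measure_congr h, measure_empty]) h0
  · filter_upwards [h] with x hx
    exact hx.mpr trivial

theorem ae_exists_zpow_neg_mem {T : Aut μ} (hT : Ergodic T μ) {B : Set X} [IsFiniteMeasure μ]
    (hB : MeasurableSet B) (h0 : μ B ≠ 0) :
    ∀ᵐ x ∂μ, ∃ m : ℕ, (T ^ (-m : ℤ)) x ∈ B := by
  refine ae_mem_of_measurableSet_invariant hT (s := {x | ∃ m : ℕ, (T ^ (-m : ℤ)) x ∈ B}) ?_ ?_ ?_
  · rw [Set.ofPred_exists]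
    exact MeasurableSet.iUnion fun m => measurable_coe (T ^ (-m : ℤ)) hB
  · rintro x ⟨m, hm⟩
    refine ⟨m + 1, ?_⟩
    have : T x = (T ^ (1 : ℤ)) x := by simp
    rw [this, ← zpow_add_apply]
    simpa using hm
  · exact fun h => h0 (measure_mono_null (fun x hx => (⟨0, by simpa using hx⟩ :
      ∃ m : ℕ, (T ^ (-m : ℤ)) x ∈ B)) h)

/-- If `T ^ k` fixed a set of positive measure, by ergodicity it would fix almost every point, and
`k` translates of a set of measure less than `1 / k` would cover the space. -/
theorem aperiodic_of_ergodic [StandardBorelSpace X] [IsProbabilityMeasure μ]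
    [NullSingletonClass μ] {T : Aut μ} (hT : Ergodic T μ) : Aperiodic T := by
  have key : ∀ k : ℕ, 0 < k → ∀ᵐ x ∂μ, (T ^ k) x ≠ x := by
    intro k hk
    let E : Set X := {x | (T ^ k) x = x}
    have hE : MeasurableSet E := measurableSet_eq_fun (measurable_coe _) measurable_id
    by_contra hcon
    have hE0 : μ E ≠ 0 := by
      simpa [ae_iff, E] using hcon
    have hEae : ∀ᵐ x ∂μ, x ∈ E := by
      refine ae_mem_of_measurableSet_invariant hT hE (fun x (hx : (T ^ k) x = x) => ?_) hE0
      change (T ^ k) (T x) = T x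
      have : (T ^ k) (T x) = T ((T ^ k) x) := by
        change (T ^ k * T : Aut μ) x = (T * T ^ k : Aut μ) x
        rw [← pow_succ, ← pow_succ']
      rw [this, hx]
    obtain ⟨B, -, hB, hB0, hBlt⟩ := exists_subset_measure_lt (μ := μ) MeasurableSet.univ
      (by simp) (ε := (k : ℝ≥0∞)⁻¹) (by simp)
    have hcov : ∀ᵐ x ∂μ, x ∈ ⋃ i ∈ Finset.range k, (T ^ i : Aut μ) '' B := by
      filter_upwards [ae_exists_zpow_neg_mem hT hB hB0, ae_forall_zpow T hEae] with x ⟨m, hm⟩ hx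
      have hper : ∀ q : ℕ, ∀ y, (∀ j : ℤ, (T ^ j) y ∈ E) → (T ^ (k * q : ℤ)) y = y := by
        intro q y hy
        induction q with
        | zero => simp
        | succ q ih =>
          have h0 : (T ^ k) y = y := by simpa [E] using hy 0
          rw [Nat.cast_succ, mul_add, mul_one, zpow_add_apply, zpow_natCast_apply, h0, ih]
      simp only [Set.mem_iUnion, Finset.mem_range]
      refine ⟨m % k, Nat.mod_lt _ hk, (T ^ (-m : ℤ)) x, hm, ?_⟩
      have h1 := hper (m / k) ((T ^ (-m : ℤ)) x) fun j => by
        rw [← zpow_add_apply]; exact hx _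
      conv_lhs => rw [← zpow_natCast, ← h1]
      rw [← zpow_add_apply, ← zpow_add_apply]
      have : ((m % k : ℕ) : ℤ) + k * (m / k : ℕ) + -m = 0 := by
        have := Nat.mod_add_div m k
        zify at this ⊢
        linarith
      rw [this]; simp
    have h1 : (1 : ℝ≥0∞) ≤ k * μ B := by
      calc (1 : ℝ≥0∞) = μ (⋃ i ∈ Finset.range k, (T ^ i : Aut μ) '' B) := by
            rw [eq_comm, ← prob_compl_eq_zero_iff₀]
            · exact hcov
            · exact (Finset.measurableSet_biUnion _ fun i _ =>
                measurableSet_image _ hB).nullMeasurableSet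
        _ ≤ ∑ i ∈ Finset.range k, μ ((T ^ i : Aut μ) '' B) := measure_biUnion_finset_le _ _
        _ = ∑ i ∈ Finset.range k, μ B := Finset.sum_congr rfl fun i _ => measure_image _ _
        _ = k * μ B := by simp
    have h2 : k * μ B < 1 := by
      rw [mul_comm]
      rwa [← ENNReal.lt_div_iff_mul_lt (by simp) (by simp), one_div]
    exact absurd h1 (not_le.2 h2)
  have : ∀ᵐ x ∂μ, ∀ k : ℕ, 0 < k → (T ^ k) x ≠ x := by
    rw [ae_all_iff]; intro k
    by_cases hk : 0 < k
    · filter_upwards [key k hk] with x hx _ using hx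
    · simp [hk]
  filter_upwards [this] with x hx
  have hinj : Function.Injective fun k : ℤ => (T ^ k) x := by
    have aux : ∀ i j : ℤ, i < j → (T ^ i) x ≠ (T ^ j) x := by
      intro i j hij h
      refine hx (j - i).toNat (by omega) ?_
      rw [← zpow_natCast_apply, Int.toNat_of_nonneg (by omega), sub_eq_neg_add, zpow_add_apply, ← h,
        zpow_neg_apply_zpow]
    intro i j h
    rcases lt_trichotomy i j with hij | hij | hij
    · exact absurd h (aux i j hij)
    · exact hij
    · exact absurd h.symm (aux j i hij)
  exact Set.infinite_range_of_injective hinj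

/-! ### Return times and induced transformations -/

section InducedTransformation

/-- The points of `A` whose `T`-orbit visits `A` infinitely often in the past and in the future. -/
def recurrentPart (T : Aut μ) (A : Set X) : Set X :=
  {x | x ∈ A ∧ (∀ j : ℤ, ∃ m, j < m ∧ (T ^ m) x ∈ A) ∧ ∀ j : ℤ, ∃ m, m < j ∧ (T ^ m) x ∈ A}

theorem recurrentPart_inv (T : Aut μ) (A : Set X) :
    recurrentPart T⁻¹ A = recurrentPart T A := by
  have key : ∀ T : Aut μ, recurrentPart T A ⊆ recurrentPart T⁻¹ A := by
    rintro T x ⟨hx, h₁, h₂⟩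
    refine ⟨hx, fun j => ?_, fun j => ?_⟩
    · obtain ⟨m, hm, hmx⟩ := h₂ (-j)
      exact ⟨-m, by omega, by simpa using hmx⟩
    · obtain ⟨m, hm, hmx⟩ := h₁ (-j)
      exact ⟨-m, by omega, by simpa using hmx⟩
  exact Set.Subset.antisymm (by simpa using key T⁻¹) (key T)

theorem zpow_mem_recurrentPart {T : Aut μ} {A : Set X} {x : X} (hx : x ∈ recurrentPart T A)
    {k : ℤ} (hk : (T ^ k) x ∈ A) : (T ^ k) x ∈ recurrentPart T A := by
  obtain ⟨-, h₁, h₂⟩ := hx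
  refine ⟨hk, fun j => ?_, fun j => ?_⟩
  · obtain ⟨m, hm, hmx⟩ := h₁ (j + k)
    exact ⟨m - k, by omega, by rw [← zpow_add_apply]; simpa using hmx⟩
  · obtain ⟨m, hm, hmx⟩ := h₂ (j + k)
    exact ⟨m - k, by omega, by rw [← zpow_add_apply]; simpa using hmx⟩

theorem measurableSet_recurrentPart (T : Aut μ) {A : Set X} (hA : MeasurableSet A) :
    MeasurableSet (recurrentPart T A) := by
  have h : ∀ m : ℤ, MeasurableSet {x | (T ^ m) x ∈ A} := fun m => measurable_coe (T ^ m) hA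
  have : recurrentPart T A = A ∩ ((⋂ j : ℤ, ⋃ m : ℤ, ⋃ _ : j < m, {x | (T ^ m) x ∈ A}) ∩
      ⋂ j : ℤ, ⋃ m : ℤ, ⋃ _ : m < j, {x | (T ^ m) x ∈ A}) := by
    ext x; simp [recurrentPart]; tauto
  rw [this]
  exact hA.inter ((MeasurableSet.iInter fun j => .iUnion fun m => .iUnion fun _ => h m).inter
    (MeasurableSet.iInter fun j => .iUnion fun m => .iUnion fun _ => h m))

/-- Poincaré recurrence, applied to `T` and to its inverse. -/
theorem ae_mem_recurrentPart [IsFiniteMeasure μ] (T : Aut μ) {A : Set X}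
    (hA : MeasurableSet A) : ∀ᵐ x ∂μ, x ∈ A → x ∈ recurrentPart T A := by
  have h₁ := (measurePreserving_coe T).conservative.ae_mem_imp_frequently_image_mem
    hA.nullMeasurableSet
  have h₂ := (measurePreserving_coe T⁻¹).conservative.ae_mem_imp_frequently_image_mem
    hA.nullMeasurableSet
  filter_upwards [h₁, h₂] with x hx₁ hx₂ hx
  refine ⟨hx, fun j => ?_, fun j => ?_⟩
  · obtain ⟨m, hm, hmx⟩ := frequently_atTop.1 (hx₁ hx) (j.toNat + 1)
    refine ⟨m, by omega, ?_⟩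
    rwa [iterate_eq_pow, ← zpow_natCast_apply] at hmx
  · obtain ⟨m, hm, hmx⟩ := frequently_atTop.1 (hx₂ hx) ((-j).toNat + 1)
    refine ⟨-m, by omega, ?_⟩
    rwa [iterate_eq_pow, ← zpow_natCast_apply, inv_zpow'] at hmx

theorem returnTime_eq {T : Aut μ} {A : Set X} {x : X} {m : ℕ} (hm : 1 ≤ m)
    (hmx : (T ^ m) x ∈ A) (h : ∀ i, 1 ≤ i → i < m → (T ^ i) x ∉ A) : returnTime T A x = m := by
  refine le_antisymm (Nat.sInf_le ⟨hm, hmx⟩) (le_csInf ⟨m, hm, hmx⟩ fun i hi => ?_)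
  by_contra hlt
  exact h i hi.1 (not_le.1 hlt) hi.2

theorem pow_notMem_of_lt_returnTime {T : Aut μ} {A : Set X} {x : X} {i : ℕ} (hi : 1 ≤ i)
    (h : i < returnTime T A x) : (T ^ i) x ∉ A :=
  fun hx => Nat.notMem_of_lt_sInf h ⟨hi, hx⟩

theorem returnTime_spec {T : Aut μ} {A : Set X} {x : X} (hx : x ∈ recurrentPart T A) :
    1 ≤ returnTime T A x ∧ (T ^ returnTime T A x) x ∈ A := by
  obtain ⟨m, hm, hmx⟩ := hx.2.1 0
  refine Nat.sInf_mem (s := {m : ℕ | 1 ≤ m ∧ (T ^ m) x ∈ A}) ⟨m.toNat, by omega, ?_⟩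
  rwa [← zpow_natCast_apply, Int.toNat_of_nonneg hm.le]

theorem measurable_returnTime (T : Aut μ) {A : Set X} (hA : MeasurableSet A) :
    Measurable (returnTime T A) := by
  classical
  let q : X → ℕ → Prop := fun x m => (1 ≤ m ∧ (T ^ m) x ∈ A) ∨ ∀ i, ¬ (1 ≤ i ∧ (T ^ i) x ∈ A)
  have hm : ∀ m : ℕ, MeasurableSet {x | 1 ≤ m ∧ (T ^ m) x ∈ A} := fun m =>
    (MeasurableSet.const _).inter (measurable_coe (T ^ m) hA)
  have hq : ∀ m, MeasurableSet {x | q x m} := fun m => by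
    refine (hm m).union (s₂ := {x | ∀ i, ¬ (1 ≤ i ∧ (T ^ i) x ∈ A)}) ?_
    rw [Set.ofPred_forall]
    exact MeasurableSet.iInter fun i => (hm i).compl
  have he : ∀ x, ∃ m, q x m := fun x => by
    by_cases h : ∃ m, 1 ≤ m ∧ (T ^ m) x ∈ A
    · exact h.imp fun m hm => Or.inl hm
    · exact ⟨0, Or.inr (not_exists.1 h)⟩
  convert measurable_find he hq using 1
  ext x
  by_cases h : ∃ m, 1 ≤ m ∧ (T ^ m) x ∈ A
  · have hs := Nat.find_spec (he x)
    have hs' : 1 ≤ Nat.find (he x) ∧ (T ^ Nat.find (he x)) x ∈ A :=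
      hs.resolve_right fun h' => not_exists.2 h' h
    exact returnTime_eq hs'.1 hs'.2 fun i hi hlt hmem =>
      Nat.find_min (he x) hlt (Or.inl ⟨hi, hmem⟩)
  · have h0 : Nat.find (he x) = 0 := (Nat.find_eq_zero (he x)).2 (Or.inr (not_exists.1 h))
    rw [h0]
    exact Nat.sInf_eq_zero.2 (Or.inr (Set.eq_empty_of_forall_notMem (not_exists.1 h)))

open Classical in
/-- The return time to `A` on the recurrent part of `A`, and `0` elsewhere. -/
noncomputable def inducedTime (T : Aut μ) (A : Set X) (x : X) : ℕ :=
  if x ∈ recurrentPart T A then returnTime T A x else 0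

theorem inducedTime_of_mem {T : Aut μ} {A : Set X} {x : X} (hx : x ∈ recurrentPart T A) :
    inducedTime T A x = returnTime T A x := if_pos hx

theorem inducedTime_of_notMem {T : Aut μ} {A : Set X} {x : X} (hx : x ∉ recurrentPart T A) :
    inducedTime T A x = 0 := if_neg hx

theorem measurable_inducedTime (T : Aut μ) {A : Set X} (hA : MeasurableSet A) :
    Measurable (inducedTime T A) :=
  Measurable.ite (measurableSet_recurrentPart T hA) (measurable_returnTime T hA) measurable_const

/-- No visit to `A` occurs strictly between a point and its first return, so the backward return
takes the same time. Hence the induced map is bijective everywhere, not only almost everywhere. -/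
theorem inducedTime_inv_apply (T : Aut μ) (A : Set X) (x : X) :
    inducedTime T⁻¹ A ((T ^ inducedTime T A x) x) = inducedTime T A x := by
  by_cases hx : x ∈ recurrentPart T A
  · obtain ⟨h1, h2⟩ := returnTime_spec hx
    rw [inducedTime_of_mem hx]
    rw [← zpow_natCast_apply] at h2 ⊢
    have h3 := zpow_mem_recurrentPart hx h2
    have h4 : ∀ i : ℕ, ((T⁻¹) ^ i) ((T ^ (returnTime T A x : ℤ)) x) =
        (T ^ ((returnTime T A x : ℤ) - i)) x := by
      intro i
      rw [← zpow_natCast_apply, inv_zpow', ← zpow_add_apply]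
      congr 3; ring
    rw [inducedTime_of_mem (by rwa [recurrentPart_inv])]
    refine returnTime_eq h1 ?_ fun i hi hlt => ?_
    · rw [h4]; simpa using hx.1
    · rw [h4, ← Nat.cast_sub hlt.le, zpow_natCast_apply]
      exact pow_notMem_of_lt_returnTime (by omega) (by omega)
  · have h0 := inducedTime_of_notMem hx
    rw [h0]
    simpa using inducedTime_of_notMem (by rwa [recurrentPart_inv])

theorem pow_inducedTime_inv_apply (T : Aut μ) (A : Set X) (x : X) :
    (T⁻¹ ^ inducedTime T⁻¹ A ((T ^ inducedTime T A x) x)) ((T ^ inducedTime T A x) x) = x := by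
  rw [inducedTime_inv_apply, inv_pow]
  exact Equiv.symm_apply_apply _ _

/-- The transformation induced by `T` on `A`; it is the identity off the recurrent part of `A`. -/
noncomputable def inducedPerm (T : Aut μ) (A : Set X) : Equiv.Perm X where
  toFun x := (T ^ inducedTime T A x) x
  invFun x := (T⁻¹ ^ inducedTime T⁻¹ A x) x
  left_inv := pow_inducedTime_inv_apply T A
  right_inv x := by simpa using pow_inducedTime_inv_apply T⁻¹ A x

/-- Kac's inequality: the integral is the sum of the measures of the sets where the time exceeds
`m`, and their images under `T ^ m` are the disjoint levels of a skyscraper over `A`. -/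
theorem lintegral_inducedTime_le (T : Aut μ) {A : Set X} (hA : MeasurableSet A) :
    ∫⁻ x, (inducedTime T A x : ℝ≥0∞) ∂μ ≤ μ Set.univ := by
  have hmeas : ∀ m : ℕ, MeasurableSet {x | m < inducedTime T A x} := fun m =>
    measurable_inducedTime T hA (measurableSet_Ioi (a := m))
  have hsum : ∀ x, (inducedTime T A x : ℝ≥0∞) =
      ∑' m : ℕ, {x | m < inducedTime T A x}.indicator (fun _ => (1 : ℝ≥0∞)) x := by
    intro x
    rw [tsum_eq_sum (s := Finset.range (inducedTime T A x))]
    · rw [Finset.sum_congr rfl (g := fun _ => 1)]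
      · simp
      · intro m hm
        exact Set.indicator_of_mem (by simpa using hm) _
    · intro m hm
      exact Set.indicator_of_notMem (by simpa using hm) _
  have hspec : ∀ m x, m < inducedTime T A x → x ∈ A ∧ m < returnTime T A x := by
    intro m x h
    by_cases hx : x ∈ recurrentPart T A
    · exact ⟨hx.1, by rwa [inducedTime_of_mem hx] at h⟩
    · rw [inducedTime_of_notMem hx] at h; omega
  -- A coincidence would make `x` a visit of `y` to `A` at time `j - i`, before its first return.
  have aux : ∀ i j x y, i < j → i < inducedTime T A x → j < inducedTime T A y →
      (T ^ i) x ≠ (T ^ j) y := by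
    intro i j x y hij hx hy h
    have h1 : x = (T ^ (j - i)) y := by
      refine injective_coe (T ^ i) ?_
      rw [h]
      change _ = (T ^ i * T ^ (j - i) : Aut μ) y
      rw [← pow_add, Nat.add_sub_cancel' hij.le]
    have h2 := (hspec _ _ hx).1
    rw [h1] at h2
    have h3 := (hspec _ _ hy).2
    exact pow_notMem_of_lt_returnTime (by omega) (by omega) h2
  calc ∫⁻ x, (inducedTime T A x : ℝ≥0∞) ∂μ
      = ∑' m : ℕ, μ {x | m < inducedTime T A x} := by
        simp_rw [hsum]
        rw [lintegral_tsum fun m => (measurable_const.indicator (hmeas m)).aemeasurable]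
        congr 1; ext m
        rw [lintegral_indicator_const (hmeas m), one_mul]
    _ = ∑' m : ℕ, μ ((T ^ m : Aut μ) '' {x | m < inducedTime T A x}) := by
        congr 1; ext m; rw [measure_image]
    _ = μ (⋃ m : ℕ, (T ^ m : Aut μ) '' {x | m < inducedTime T A x}) := by
        refine (measure_iUnion (fun i j hij => ?_) fun m => measurableSet_image _ (hmeas m)).symm
        refine Set.disjoint_left.2 ?_
        rintro _ ⟨x, hx, rfl⟩ ⟨y, hy, hxy⟩
        rcases lt_or_gt_of_ne hij with h | h
        · exact aux i j x y h hx hy hxy.symm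
        · exact aux j i y x h hy hx hxy
    _ ≤ μ Set.univ := measure_mono (Set.subset_univ _)

variable [StandardBorelSpace X]

theorem inducedPerm_mem_aut (T : Aut μ) {A : Set X} (hA : MeasurableSet A) :
    inducedPerm T A ∈ Aut μ :=
  mem_aut_of_forall_zpow T _ (measurable_pow_apply T (measurable_inducedTime T hA))
    fun x => ⟨inducedTime T A x, by rw [zpow_natCast]; rfl⟩

/-- The transformation induced by `T` on the measurable set `A`, as an element of `Aut μ`. -/
noncomputable def induced (T : Aut μ) {A : Set X} (hA : MeasurableSet A) : Aut μ :=
  ⟨inducedPerm T A, inducedPerm_mem_aut T hA⟩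

section

variable {T : Aut μ} {A : Set X} {hA : MeasurableSet A}

theorem induced_apply (x : X) : induced T hA x = (T ^ inducedTime T A x) x := rfl

theorem induced_of_notMem {x : X} (hx : x ∉ A) : induced T hA x = x := by
  rw [induced_apply, inducedTime_of_notMem fun h => hx h.1]; simp

theorem induced_mem {x : X} (hx : x ∈ A) : induced T hA x ∈ A := by
  rw [induced_apply]
  by_cases h : x ∈ recurrentPart T A
  · rw [inducedTime_of_mem h]; exact (returnTime_spec h).2
  · rw [inducedTime_of_notMem h]; simpa using hx

theorem induced_mem_iff {x : X} : induced T hA x ∈ A ↔ x ∈ A :=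
  ⟨fun h => by_contra fun hx => hx (by rwa [induced_of_notMem hx] at h), induced_mem⟩

theorem induced_pow_mem_iff {x : X} (k : ℕ) : (induced T hA ^ k) x ∈ A ↔ x ∈ A := by
  induction k with
  | zero => simp
  | succ k ih =>
    rw [pow_succ', ← ih]
    exact induced_mem_iff (hA := hA)

theorem induced_mem_recurrentPart {x : X} (hx : x ∈ recurrentPart T A) :
    induced T hA x ∈ recurrentPart T A := by
  have := induced_mem (T := T) (hA := hA) hx.1
  rw [induced_apply, ← zpow_natCast_apply] at this ⊢
  exact zpow_mem_recurrentPart hx this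

theorem induced_pow_apply (x : X) (k : ℕ) :
    (induced T hA ^ k) x =
      (T ^ ∑ j ∈ Finset.range k, inducedTime T A ((induced T hA ^ j) x)) x := by
  induction k with
  | zero => simp
  | succ k ih =>
    rw [pow_succ' _ k, Finset.sum_range_succ, add_comm (∑ j ∈ _, _), pow_add]
    change induced T hA ((induced T hA ^ k) x) = (T ^ _) ((T ^ _) x)
    rw [induced_apply, ← ih]

theorem ae_induced_eq_firstReturn [IsFiniteMeasure μ] (T : Aut μ) (hA : MeasurableSet A) :
    ∀ᵐ x ∂μ, induced T hA x = firstReturn T A x := by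
  filter_upwards [ae_mem_recurrentPart T hA] with x hx
  by_cases h : x ∈ A
  · rw [firstReturn, if_pos h, induced_apply, inducedTime_of_mem (hx h)]
  · rw [firstReturn, if_neg h, induced_of_notMem h]

/-- Here `k` counts the visits to `A` up to time `m`, whence `k ≤ m`. -/
theorem exists_induced_pow_eq {x : X} (hx : x ∈ recurrentPart T A) {m : ℕ}
    (hm : (T ^ m) x ∈ A) : ∃ k ≤ m, (induced T hA ^ k) x = (T ^ m) x := by
  induction m using Nat.strong_induction_on generalizing x with
  | _ m ih =>
    rcases Nat.eq_zero_or_pos m with rfl | hpos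
    · exact ⟨0, le_rfl, by simp⟩
    · have hr := returnTime_spec hx
      have hrm : returnTime T A x ≤ m := Nat.sInf_le ⟨hpos, hm⟩
      have hSx : induced T hA x = (T ^ returnTime T A x) x := by
        rw [induced_apply, inducedTime_of_mem hx]
      have hTm : (T ^ (m - returnTime T A x)) (induced T hA x) = (T ^ m) x := by
        rw [hSx]
        change (T ^ (m - returnTime T A x) * T ^ returnTime T A x : Aut μ) x = _
        rw [← pow_add, Nat.sub_add_cancel hrm]
      obtain ⟨k, hk, hkx⟩ := ih (m - returnTime T A x) (by omega)
        (induced_mem_recurrentPart (hA := hA) hx) (by rwa [hTm])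
      refine ⟨k + 1, by omega, ?_⟩
      rw [pow_succ, ← hTm, ← hkx]
      rfl

theorem exists_induced_zpow_eq {x : X} (hx : x ∈ recurrentPart T A) {m : ℤ}
    (hm : (T ^ m) x ∈ A) :
    ∃ k : ℤ, k.natAbs ≤ m.natAbs ∧ (induced T hA ^ k) x = (T ^ m) x := by
  obtain ⟨m, rfl | rfl⟩ := m.eq_nat_or_neg
  · rw [zpow_natCast_apply] at hm ⊢
    obtain ⟨k, hk, hkx⟩ := exists_induced_pow_eq (hA := hA) hx hm
    exact ⟨k, by simpa using hk, by rw [zpow_natCast_apply, hkx]⟩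
  · have hyx : (T ^ m) ((T ^ (-m : ℤ)) x) = x := by
      rw [← zpow_natCast_apply]
      exact zpow_apply_zpow_neg _ _ _
    obtain ⟨k, hk, hkx⟩ := exists_induced_pow_eq (hA := hA) (zpow_mem_recurrentPart hx hm) (m := m)
      (by rw [hyx]; exact hx.1)
    refine ⟨-k, by simpa using hk, ?_⟩
    rw [hyx] at hkx
    rw [← zpow_neg_apply_zpow (induced T hA) k ((T ^ (-m : ℤ)) x), zpow_natCast_apply, hkx]

end

end InducedTransformation

/-! ### Rokhlin towers and partitions into pieces of orbits -/

section Towers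

/-- Rokhlin's lemma, with the base of the tower read off from the last visit to a marker set `B`. -/
theorem exists_tower (S : Aut μ) {A B : Set X} (hA : MeasurableSet A) (hB : MeasurableSet B)
    {n : ℕ} (hn : 0 < n) (hSA : ∀ (k : ℕ) x, (S ^ k) x ∈ A ↔ x ∈ A)
    (hhit : ∀ᵐ x ∂μ, x ∈ A → ∃ m : ℕ, (S ^ (-m : ℤ)) x ∈ B) :
    ∃ C ⊆ A, MeasurableSet C ∧
      (∀ x ∈ C, ∀ y ∈ C, ∀ i < n, ∀ j < n, (S ^ i) x = (S ^ j) y → i = j) ∧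
      μ (A \ ⋃ i ∈ Finset.range n, (S ^ i : Aut μ) '' C) ≤ n * μ B := by
  have hpre : ∀ k : ℤ, MeasurableSet {x | (S ^ k) x ∈ B} := fun k => measurable_coe (S ^ k) hB
  -- The time since the last visit to `B` is a multiple of `n`, and the next `n - 1` steps avoid
  -- `B`, so that each column lies between two visits.
  let C : Set X := {x | x ∈ A ∧ (∃ q : ℕ, (S ^ (-(q * n : ℕ) : ℤ)) x ∈ B ∧
    ∀ m < q * n, (S ^ (-m : ℤ)) x ∉ B) ∧ ∀ l : ℕ, 1 ≤ l → l < n → (S ^ (l : ℤ)) x ∉ B}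
  have hC : MeasurableSet C := by
    have : C = A ∩ ((⋃ q : ℕ, {x | (S ^ (-(q * n : ℕ) : ℤ)) x ∈ B} ∩
        ⋂ m : ℕ, ⋂ _ : m < q * n, {x | (S ^ (-m : ℤ)) x ∈ B}ᶜ) ∩
        ⋂ l : ℕ, ⋂ _ : 1 ≤ l, ⋂ _ : l < n, {x | (S ^ (l : ℤ)) x ∈ B}ᶜ) := by
      ext x
      simp only [C, Set.mem_ofPred_eq, Set.mem_inter_iff, Set.mem_iUnion, Set.mem_iInter,
        Set.mem_compl_iff]
    rw [this]
    refine hA.inter (MeasurableSet.inter ?_ ?_)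
    · exact .iUnion fun q => (hpre _).inter (.iInter fun m => .iInter fun _ => (hpre _).compl)
    · exact .iInter fun l => .iInter fun _ => .iInter fun _ => (hpre _).compl
  have aux : ∀ x ∈ C, ∀ y ∈ C, ∀ i < n, ∀ j < n, i < j → (S ^ i) x ≠ (S ^ j) y := by
    rintro x ⟨-, ⟨q, hq, hq'⟩, -⟩ y ⟨-, ⟨p, hp, hp'⟩, hy⟩ i hi j hj hij h
    have hx : x = (S ^ ((j - i : ℕ) : ℤ)) y := by
      refine injective_coe (S ^ (i : ℤ)) ?_
      rw [← zpow_add_apply, zpow_natCast_apply, h, ← zpow_natCast_apply]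
      congr 3; omega
    set l := j - i
    have hsh : ∀ m : ℕ, (S ^ (-m : ℤ)) x = (S ^ ((l : ℤ) - m)) y := fun m => by
      rw [hx, ← zpow_add_apply, sub_eq_neg_add]
    -- Both points have the same last visit to `B`, so `q * n = p * n + l` with `0 < l < n`, which
    -- is absurd modulo `n`.
    have h1 : ¬ p * n + l < q * n := fun hlt => hq' _ hlt (by
      rw [hsh]
      convert hp using 4
      push_cast; ring)
    have h2 : ¬ q * n < p * n + l := fun hlt => by
      rw [hsh] at hq
      by_cases hl : q * n < l
      · refine hy (l - q * n) (by omega) (by omega) ?_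
        rwa [Nat.cast_sub hl.le]
      · refine hp' (q * n - l) (by omega) ?_
        rw [Nat.cast_sub (not_lt.1 hl), neg_sub]
        exact hq
    have h3 : q * n = p * n + l := by omega
    have h4 : (p * n + l) % n = l := by
      rw [mul_comm, Nat.mul_add_mod, Nat.mod_eq_of_lt (by omega)]
    rw [← h3, Nat.mul_mod_left] at h4
    omega
  refine ⟨C, fun x hx => hx.1, hC, fun x hx y hy i hi j hj h => ?_, ?_⟩
  · rcases lt_trichotomy i j with hij | hij | hij
    · exact absurd h (aux x hx y hy i hi j hj hij)
    · exact hij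
    · exact absurd h.symm (aux y hy x hx j hj i hi hij)
  -- A point that does not meet `B` within its next `n - 1` steps is covered: with `h` the time
  -- since its last visit, going back `h % n` steps leads into `C`.
  · have hcov : ∀ᵐ x ∂μ, x ∈ A \ (⋃ i ∈ Finset.range n, (S ^ i : Aut μ) '' C) →
        x ∈ ⋃ l ∈ Finset.range n, (S ^ l : Aut μ) ⁻¹' B := by
      classical
      filter_upwards [hhit] with x hx hxA
      have hex := hx hxA.1
      let h := Nat.find hex
      have hmin : ∀ m < h, (S ^ (-m : ℤ)) x ∉ B := fun m hm => Nat.find_min hex hm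
      by_contra hno
      simp only [Set.mem_iUnion, Finset.mem_range, Set.mem_preimage, not_exists] at hno
      refine hxA.2 ?_
      simp only [Set.mem_iUnion, Finset.mem_range]
      have hdm := Nat.mod_add_div' h n
      have hlt := Nat.mod_lt h hn
      refine ⟨h % n, hlt, (S ^ (-(h % n : ℕ) : ℤ)) x, ⟨?_, ⟨h / n, ?_, fun m hm => ?_⟩,
        fun l hl hln => ?_⟩, ?_⟩
      · rw [← hSA (h % n), ← zpow_natCast_apply, zpow_apply_zpow_neg]
        exact hxA.1
      · rw [← zpow_add_apply]
        convert Nat.find_spec hex using 4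
        change _ = -(h : ℤ)
        omega
      · rw [← zpow_add_apply, ← neg_add, ← Nat.cast_add]
        exact hmin _ (by omega)
      · rw [← zpow_add_apply]
        by_cases hlh : l ≤ h % n
        · rw [show (l : ℤ) + -(h % n : ℕ) = -(h % n - l : ℕ) by omega]
          exact hmin _ (by have := Nat.mod_le h n; omega)
        · rw [show (l : ℤ) + -(h % n : ℕ) = (l - h % n : ℕ) by omega, zpow_natCast_apply]
          exact hno _ (by omega)
      · rw [← zpow_natCast_apply, zpow_apply_zpow_neg]
    calc μ (A \ ⋃ i ∈ Finset.range n, (S ^ i : Aut μ) '' C)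
        ≤ μ (⋃ l ∈ Finset.range n, (S ^ l : Aut μ) ⁻¹' B) := measure_mono_ae hcov
      _ ≤ ∑ l ∈ Finset.range n, μ ((S ^ l : Aut μ) ⁻¹' B) := measure_biUnion_finset_le _ _
      _ = ∑ l ∈ Finset.range n, μ B := Finset.sum_congr rfl fun l _ =>
          (measurePreserving_coe (S ^ l)).measure_preimage hB.nullMeasurableSet
      _ = n * μ B := by simp

theorem setLIntegral_le_of_le_add_mul {ψ : ℕ → ℝ≥0} {c δ : ℝ≥0} (h : ∀ t, ψ t ≤ c + δ * t)
    {R : X → ℕ} (hR : Measurable R) {C : Set X} (hC : MeasurableSet C) {ρ : X → ℕ}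
    (hρ : Set.EqOn ρ R C) :
    ∫⁻ x in C, (ψ (ρ x) : ℝ≥0∞) ∂μ ≤ c * μ C + δ * ∫⁻ x, (R x : ℝ≥0∞) ∂μ := by
  have hR' : Measurable fun x => (R x : ℝ≥0∞) :=
    (measurable_from_top (f := ((↑) : ℕ → ℝ≥0∞))).comp hR
  calc ∫⁻ x in C, (ψ (ρ x) : ℝ≥0∞) ∂μ
      ≤ ∫⁻ x in C, ((c : ℝ≥0∞) + δ * (R x : ℕ)) ∂μ := by
        refine setLIntegral_mono' hC fun x hx => ?_
        rw [hρ hx]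
        exact_mod_cast h (R x)
    _ = c * μ C + δ * ∫⁻ x in C, (R x : ℝ≥0∞) ∂μ := by
        rw [lintegral_add_left measurable_const, setLIntegral_const, lintegral_const_mul _ hR']
    _ ≤ c * μ C + δ * ∫⁻ x, (R x : ℝ≥0∞) ∂μ := by
        gcongr
        exact Measure.restrict_le_self

theorem lintegral_lt_top_of_geometric_bound [IsFiniteMeasure μ] {C : ℕ → Set X}
    (hC : ∀ k, MeasurableSet (C k)) {f : X → ℝ≥0} {a b : ℝ≥0}
    (hf : ∀ k, ∫⁻ x in C k, (f x : ℝ≥0∞) ∂μ ≤ a * ((1 / 2 : ℝ≥0) ^ k : ℝ≥0))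
    (hb : ∀ x ∉ ⋃ k, C k, f x ≤ b) : ∫⁻ x, (f x : ℝ≥0∞) ∂μ < ∞ := by
  have hsum : ∫⁻ x in ⋃ k, C k, (f x : ℝ≥0∞) ∂μ < ∞ := by
    refine (lintegral_iUnion_le _ _).trans_lt ((ENNReal.tsum_le_tsum hf).trans_lt ?_)
    rw [ENNReal.tsum_mul_left]
    refine ENNReal.mul_lt_top ENNReal.coe_lt_top (lt_top_iff_ne_top.2 ?_)
    refine ENNReal.tsum_coe_ne_top_iff_summable.2 (NNReal.summable_geometric ?_)
    rw [div_lt_one (by norm_num)]; norm_num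
  rw [← lintegral_add_compl _ (MeasurableSet.iUnion hC)]
  refine ENNReal.add_lt_top.2 ⟨hsum, ?_⟩
  calc ∫⁻ x in (⋃ k, C k)ᶜ, (f x : ℝ≥0∞) ∂μ ≤ ∫⁻ x in (⋃ k, C k)ᶜ, (b : ℝ≥0∞) ∂μ :=
        setLIntegral_mono' (MeasurableSet.iUnion hC).compl fun x hx => by exact_mod_cast hb x hx
    _ < ∞ := by
        rw [setLIntegral_const]
        exact ENNReal.mul_lt_top ENNReal.coe_lt_top (measure_lt_top _ _)

theorem measurable_indexed_pow_apply (S : ℕ → Aut μ) {κ : X → ℕ} (hκ : Measurable κ) (D : Set X)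
    (n : ℕ) : Measurable fun p : D × Fin n => (S (κ p.1) ^ (p.2 : ℕ)) (p.1 : X) := by
  refine measurable_from_prod_countable_left fun i => ?_
  have h₁ : Measurable fun p : ℕ × X => (S p.1 ^ (i : ℕ)) p.2 :=
    measurable_from_prod_countable_right fun k => measurable_coe (S k ^ (i : ℕ))
  have h₂ : Measurable fun x : D => (κ x, (x : X)) :=
    (hκ.comp measurable_subtype_coe).prodMk measurable_subtype_coe
  exact h₁.comp h₂

theorem measure_iInter_eq_zero_of_geometric_bound {A : ℕ → Set X}
    (hA : ∀ k, μ (A (k + 1)) ≤ ((1 / 2 : ℝ≥0) ^ (k + 1) : ℝ≥0)) : μ (⋂ k, A k) = 0 := by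
  have htend : Tendsto (fun k : ℕ => (((1 / 2 : ℝ≥0) ^ (k + 1) : ℝ≥0) : ℝ≥0∞)) atTop (𝓝 0) := by
    rw [← ENNReal.coe_zero, ENNReal.tendsto_coe, tendsto_add_atTop_iff_nat (f := fun k =>
      (1 / 2 : ℝ≥0) ^ k)]
    refine NNReal.tendsto_pow_atTop_nhds_zero_of_lt_one ?_
    rw [div_lt_one (by norm_num)]; norm_num
  have hle : ∀ k, μ (⋂ k, A k) ≤ ((1 / 2 : ℝ≥0) ^ (k + 1) : ℝ≥0) := fun k =>
    (measure_mono (Set.iInter_subset _ (k + 1))).trans (hA k)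
  exact le_antisymm (ge_of_tendsto' htend hle) zero_le

variable [StandardBorelSpace X]

/-- The marker is a subset of `A` of measure below `ε / n`. By ergodicity almost every past under
`T` meets it, hence so does the past under the induced map. -/
theorem exists_induced_tower [IsProbabilityMeasure μ] [NullSingletonClass μ] {T : Aut μ}
    (hT : Ergodic T μ) {A : Set X} (hA : MeasurableSet A) {n : ℕ} (hn : 0 < n) {ε : ℝ≥0∞}
    (hε : ε ≠ 0) :
    ∃ C ⊆ A, MeasurableSet C ∧
      (∀ x ∈ C, ∀ y ∈ C, ∀ i < n, ∀ j < n,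
        (induced T hA ^ i) x = (induced T hA ^ j) y → i = j) ∧
      μ (A \ ⋃ i ∈ Finset.range n, (induced T hA ^ i : Aut μ) '' C) ≤ ε := by
  by_cases h0 : μ A = 0
  · exact ⟨∅, Set.empty_subset _, .empty, by simp,
      (measure_mono Set.sdiff_subset).trans (h0.le.trans zero_le)⟩
  obtain ⟨B, hBA, hB, hB0, hBε⟩ := exists_subset_measure_lt hA h0
    (ε := ε / n) (ENNReal.div_pos hε (by simp)).ne'
  obtain ⟨C, hCA, hC, hdis, hcov⟩ := exists_tower (induced T hA) hA hB hn
    (fun k x => induced_pow_mem_iff k) (by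
      filter_upwards [ae_exists_zpow_neg_mem hT hB hB0,
        ae_forall_zpow T (ae_mem_recurrentPart T hA)] with x ⟨m, hm⟩ hx hxA
      have hback : (T ^ m) ((T ^ (-m : ℤ)) x) = x := by
        rw [← zpow_natCast_apply, zpow_apply_zpow_neg]
      obtain ⟨k, -, hk⟩ := exists_induced_pow_eq (hA := hA) (hx (-m) (hBA hm)) (m := m)
        (by rwa [hback])
      refine ⟨k, ?_⟩
      rw [← hback, ← hk, ← zpow_natCast_apply, zpow_neg_apply_zpow]
      exact hm)
  refine ⟨C, hCA, hC, hdis, hcov.trans ?_⟩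
  calc n * μ B ≤ n * (ε / n) := by gcongr
    _ ≤ ε := ENNReal.mul_div_le

theorem lintegral_sum_inducedTime_le (T : Aut μ) {A : Set X} (hA : MeasurableSet A) (n : ℕ) :
    ∫⁻ x, ((∑ j ∈ Finset.range n, inducedTime T A ((induced T hA ^ j) x) : ℕ) : ℝ≥0∞) ∂μ ≤
      n * μ Set.univ := by
  have hm : Measurable fun x => (inducedTime T A x : ℝ≥0∞) :=
    (measurable_from_top (f := ((↑) : ℕ → ℝ≥0∞))).comp (measurable_inducedTime T hA)
  simp_rw [Nat.cast_sum]
  rw [lintegral_finsetSum (f := fun j x => (inducedTime T A ((induced T hA ^ j) x) : ℝ≥0∞)) _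
    fun j _ => hm.comp (measurable_coe _)]
  calc _ ≤ ∑ j ∈ Finset.range n, μ Set.univ := Finset.sum_le_sum fun j _ => by
        rw [(measurePreserving_coe (induced T hA ^ j)).lintegral_comp hm]
        exact lintegral_inducedTime_le T hA
    _ = _ := by simp

/-- Successive towers of height `n` over sets `C k`, the tower over `C k` being built for the
transformation induced on the part `A k` of the space not covered before. -/
theorem exists_tower_sequence [IsProbabilityMeasure μ] [NullSingletonClass μ] {T : Aut μ}
    (hT : Ergodic T μ) {n : ℕ} (hn : 0 < n) {ε : ℕ → ℝ≥0∞} (hε : ∀ k, ε k ≠ 0) :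
    ∃ (A C : ℕ → Set X) (hA : ∀ k, MeasurableSet (A k)), (∀ k, MeasurableSet (C k)) ∧
      (∀ k, C k ⊆ A k) ∧ (∀ k, μ (A (k + 1)) ≤ ε (k + 1)) ∧
      (∀ k l, ∀ x ∈ C k, ∀ y ∈ C l, ∀ i < n, ∀ j < n,
        (induced T (hA k) ^ i) x = (induced T (hA l) ^ j) y → k = l ∧ i = j) ∧
      ∀ y ∉ ⋂ k, A k, ∃ k, ∃ i < n, ∃ x ∈ C k, (induced T (hA k) ^ i) x = y := by
  choose C' hCA' hC' hdis' hcov' using fun (A : {A : Set X // MeasurableSet A}) (k : ℕ) =>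
    exists_induced_tower hT A.2 hn (hε (k + 1))
  let next : ℕ → {A : Set X // MeasurableSet A} → {A : Set X // MeasurableSet A} := fun k A =>
    ⟨A \ ⋃ i ∈ Finset.range n, (induced T A.2 ^ i : Aut μ) '' C' A k,
      A.2.diff (Finset.measurableSet_biUnion _ fun i _ => measurableSet_image _ (hC' A k))⟩
  let A : ℕ → {A : Set X // MeasurableSet A} := fun k => Nat.rec (motive := fun _ => {A : Set X // MeasurableSet A})
    ⟨Set.univ, .univ⟩ next k
  let S : ℕ → Aut μ := fun k => induced T (A k).2
  let C : ℕ → Set X := fun k => C' (A k) k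
  have hA0 : (A 0 : Set X) = Set.univ := rfl
  have hAs : ∀ k, (A (k + 1) : Set X) = (A k : Set X) \ ⋃ i ∈ Finset.range n, (S k ^ i : Aut μ) '' C k :=
    fun k => rfl
  have hCA : ∀ k, C k ⊆ A k := fun k => hCA' _ _
  have hC : ∀ k, MeasurableSet (C k) := fun k => hC' _ _
  have hdis : ∀ k, ∀ x ∈ C k, ∀ y ∈ C k, ∀ i < n, ∀ j < n,
      (S k ^ i) x = (S k ^ j) y → i = j := fun k => hdis' _ _
  have hμA : ∀ k, μ (A (k + 1)) ≤ ε (k + 1) := fun k => hcov' _ _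
  clear_value A
  -- The `k`-th tower lies in `A k` and misses `A (k + 1)`; as these sets decrease, distinct towers
  -- are disjoint.
  have hanti : Antitone fun k => (A k : Set X) := antitone_nat_of_succ_le fun k => by
    rw [hAs]; exact Set.sdiff_subset
  have hlev : ∀ k, ∀ x ∈ C k, ∀ i < n, (S k ^ i) x ∈ (A k : Set X) ∧
      (S k ^ i) x ∉ (A (k + 1) : Set X) := by
    intro k x hx i hi
    refine ⟨(induced_pow_mem_iff i).2 (hCA k hx), fun h => ?_⟩
    rw [hAs] at h
    exact h.2 (Set.mem_biUnion (Finset.mem_coe.2 (Finset.mem_range.2 hi)) ⟨x, hx, rfl⟩)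
  have hkl : ∀ k l, ∀ x ∈ C k, ∀ y ∈ C l, ∀ i < n, ∀ j < n,
      (S k ^ i) x = (S l ^ j) y → k = l := by
    have aux : ∀ k l, ∀ x ∈ C k, ∀ y ∈ C l, ∀ i < n, ∀ j < n, k < l →
        (S k ^ i) x ≠ (S l ^ j) y := by
      intro k l x hx y hy i hi j hj hlt h
      refine (hlev k x hx i hi).2 ?_
      rw [h]
      exact hanti (Nat.succ_le_of_lt hlt) (hlev l y hy j hj).1
    intro k l x hx y hy i hi j hj h
    rcases lt_trichotomy k l with hlt | hlt | hlt
    · exact absurd h (aux k l x hx y hy i hi j hj hlt)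
    · exact hlt
    · exact absurd h.symm (aux l k y hy x hx j hj i hi hlt)
  refine ⟨fun k => A k, C, fun k => (A k).2, hC, hCA, hμA,
    fun k l x hx y hy i hi j hj h => ?_, fun y hy => ?_⟩
  · obtain rfl := hkl k l x hx y hy i hi j hj h
    exact ⟨rfl, hdis k x hx y hy i hi j hj h⟩
  · by_contra hno
    refine hy (Set.mem_iInter.2 fun k => ?_)
    induction k with
    | zero => rw [hA0]; trivial
    | succ k ih =>
      rw [hAs]
      refine ⟨ih, fun h => hno ?_⟩
      simp only [Set.mem_iUnion, Finset.mem_range] at h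
      obtain ⟨i, hi, x, hx, rfl⟩ := h
      exact ⟨k, i, hi, x, hx, rfl⟩

/-- `X` is partitioned, up to a null set, into `n`-point subsets of `T`-orbits, each with its first
point in `D`, such that the function `ψ` of the lengths of these subsets is integrable. -/
theorem exists_orbit_partition [IsProbabilityMeasure μ] [NullSingletonClass μ] {T : Aut μ}
    (hT : Ergodic T μ) {ψ : ℕ → ℝ≥0} (hψ : ∀ δ : ℝ≥0, 0 < δ → ∃ c : ℝ≥0, ∀ t, ψ t ≤ c + δ * t)
    (n : ℕ) [NeZero n] :
    ∃ (D : Set X) (Φ : D × Fin n → X) (ρ : X → ℕ), MeasurableSet D ∧ Measurable Φ ∧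
      Function.Injective Φ ∧ (∀ x : D, Φ (x, 0) = x) ∧ (∀ᵐ y ∂μ, y ∈ Set.range Φ) ∧ Measurable ρ ∧
      (∀ (x : D) i, ∃ m ≤ ρ x, Φ (x, i) = (T ^ m) x) ∧ ∫⁻ x, ψ (ρ x) ∂μ < ∞ := by
  classical
  have hn : 0 < n := Nat.pos_of_ne_zero (NeZero.ne n)
  choose c hc using fun k : ℕ => hψ ((1 / 2) ^ k) (by positivity)
  -- Chosen so that both `c k * ε k` and `ε k` are at most `2^{-k}`.
  let ε : ℕ → ℝ≥0 := fun k => (1 / 2) ^ k / (c k + 1)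
  have hε : ∀ k, (ε k : ℝ≥0∞) ≠ 0 := fun k => by
    have : 0 < ε k := by positivity
    exact_mod_cast this.ne'
  obtain ⟨A, C, hA, hC, hCA, hμA, hdis, hcov⟩ := exists_tower_sequence hT hn hε
  let S : ℕ → Aut μ := fun k => induced T (hA k)
  obtain ⟨κ, hκ, hκC⟩ := exists_measurable_piecewise C hC (fun k _ => k)
    (fun k => measurable_const) (fun k l hne x hx => absurd
      (hdis k l x hx.1 x hx.2 0 hn 0 hn (by simp)).1 hne)
  let D : Set X := ⋃ k, C k
  have hD : MeasurableSet D := .iUnion hC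
  have hDκ : ∀ x ∈ D, x ∈ C (κ x) := fun x hx => by
    obtain ⟨k, hk⟩ := Set.mem_iUnion.1 hx
    rwa [hκC k hk]
  -- The `T`-length of `n` successive returns bounds the displacement to every level of the column.
  let R : ℕ → X → ℕ := fun k x =>
    ∑ j ∈ Finset.range n, inducedTime T (A k) ((S k ^ j) x)
  have hR : ∀ k, Measurable (R k) := fun k => Finset.measurable_sum _ fun j _ =>
    (measurable_inducedTime T (hA k)).comp (measurable_coe _)
  let ρ : X → ℕ := fun x => if x ∈ D then R (κ x) x else 0
  let Φ : D × Fin n → X := fun p => (S (κ p.1) ^ (p.2 : ℕ)) p.1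
  have hρ : Measurable ρ := by
    refine Measurable.ite hD ?_ measurable_const
    have : Measurable fun p : ℕ × X => R p.1 p.2 := measurable_from_prod_countable_right hR
    exact this.comp (hκ.prodMk measurable_id)
  have hint : ∫⁻ x, ψ (ρ x) ∂μ < ∞ := by
    refine lintegral_lt_top_of_geometric_bound hC (a := c 0 + 1 + n) (b := ψ 0) (fun k => ?_)
      fun x hx => ?_
    · have hρk : Set.EqOn ρ (R k) (C k) := fun x hx => by
        have : κ x = k := hκC k hx
        simp only [ρ]
        rw [if_pos (Set.mem_iUnion.2 ⟨k, hx⟩), this]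
      -- The first tower is built on the whole space, which is not small; this is why `c 0` enters
      -- the constant.
      have h1 : (c k : ℝ≥0∞) * μ (C k) ≤ (c 0 + 1) * ((1 / 2 : ℝ≥0) ^ k : ℝ≥0) := by
        rcases k with - | k
        · calc (c 0 : ℝ≥0∞) * μ (C 0) ≤ c 0 * 1 := by gcongr; exact prob_le_one
            _ ≤ _ := by simp
        · calc (c (k + 1) : ℝ≥0∞) * μ (C (k + 1)) ≤ c (k + 1) * ε (k + 1) := by
                gcongr; exact (measure_mono (hCA _)).trans (hμA k)
            _ ≤ ((1 / 2 : ℝ≥0) ^ (k + 1) : ℝ≥0) := by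
                norm_cast
                rw [mul_div_left_comm]
                exact mul_le_of_le_one_right zero_le (div_le_one_of_le₀ (by simp) zero_le)
            _ ≤ _ := le_mul_of_one_le_left zero_le (by simp)
      refine (setLIntegral_le_of_le_add_mul (hc k) (hR k) (hC k) hρk).trans ?_
      have h2 : ∫⁻ x, (R k x : ℝ≥0∞) ∂μ ≤ n :=
        (lintegral_sum_inducedTime_le T (hA k) n).trans_eq (by simp)
      refine (add_le_add h1 (mul_le_mul_right h2 _)).trans_eq ?_
      push_cast
      ring
    · simp only [ρ]
      rw [if_neg hx]
  refine ⟨D, Φ, ρ, hD, ?_, ?_, fun x => by simp [Φ], ?_, hρ, ?_, hint⟩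
  · exact measurable_indexed_pow_apply S hκ D n
  · rintro ⟨x, i⟩ ⟨y, j⟩ (h : (S (κ x) ^ (i : ℕ)) (x : X) = (S (κ y) ^ (j : ℕ)) (y : X))
    have hx := hDκ x x.2
    have hy := hDκ y y.2
    obtain ⟨hk, hij⟩ := hdis _ _ _ hx _ hy _ i.2 _ j.2 h
    rw [← hk, ← hij] at h
    exact Prod.ext (Subtype.ext (injective_coe _ h)) (Fin.ext hij)
  · have hnull : μ (⋂ k, A k) = 0 :=
      measure_iInter_eq_zero_of_geometric_bound fun k => (hμA k).trans (by
        norm_cast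
        exact div_le_self zero_le (by simp))
    refine measure_mono_null (fun y hy => ?_) hnull
    by_contra hyA
    obtain ⟨k, i, hi, x, hx, rfl⟩ := hcov y hyA
    have hκx : κ x = k := hκC k hx
    exact hy ⟨(⟨x, Set.mem_iUnion.2 ⟨k, hx⟩⟩, ⟨i, hi⟩), by simp only [Φ]; rw [hκx]⟩
  · intro x i
    refine ⟨_, ?_, induced_pow_apply (x : X) (i : ℕ)⟩
    simp only [ρ]
    rw [if_pos x.2]
    exact Finset.sum_le_sum_of_subset (Finset.range_mono i.2.le)

end Towers

/-! ### Subadditive domination of sublinear functions -/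

theorem Sublinear.exists_le_add_mul {φ : ℝ≥0 → ℝ≥0} (hφ : Sublinear φ) {δ : ℝ≥0} (hδ : 0 < δ) :
    ∃ c : ℝ≥0, ∀ t : ℕ, φ t ≤ c + δ * t := by
  obtain ⟨N, hN⟩ := eventually_atTop.1
    ((tendsto_natCast_atTop_atTop (R := ℝ≥0)).eventually (hφ.eventually (gt_mem_nhds hδ)))
  refine ⟨∑ t ∈ Finset.range (N + 1), φ t, fun t => ?_⟩
  by_cases ht : t < N + 1
  · exact (Finset.single_le_sum (f := fun t : ℕ => φ t) (fun _ _ => zero_le)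
      (Finset.mem_range.2 ht)).trans le_self_add
  · have h := hN t (by omega)
    have ht0 : (0 : ℝ≥0) < t := by exact_mod_cast (by omega : 0 < t)
    rw [div_lt_iff₀ ht0] at h
    exact h.le.trans le_add_self

/-- A sublinear function is dominated, on the integers, by a monotone subadditive one. -/
theorem Sublinear.exists_subadditive {φ : ℝ≥0 → ℝ≥0} (hφ : Sublinear φ) :
    ∃ ψ : ℕ → ℝ≥0, Monotone ψ ∧ (∀ s t, ψ (s + t) ≤ ψ s + ψ t) ∧ (∀ t : ℕ, φ t ≤ ψ t) ∧
      ∀ δ : ℝ≥0, 0 < δ → ∃ c : ℝ≥0, ∀ t, ψ t ≤ c + δ * t := by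
  choose c hc using fun δ : {δ : ℝ≥0 // 0 < δ} => hφ.exists_le_add_mul δ.2
  have : Nonempty {δ : ℝ≥0 // 0 < δ} := ⟨⟨1, one_pos⟩⟩
  -- `ψ` is the infimum of affine majorants of `φ`, one for each positive slope.
  let g : ℕ → {δ : ℝ≥0 // 0 < δ} → ℝ≥0 := fun t δ => c δ + δ * t
  have hle : ∀ t δ, ⨅ δ, g t δ ≤ g t δ := fun t δ => ciInf_le (OrderBot.bddBelow _) δ
  refine ⟨fun t => ⨅ δ, g t δ, fun s t hst => ?_, fun s t => ?_, fun t => ?_, fun δ hδ => ?_⟩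
  · refine le_ciInf fun δ => (hle s δ).trans ?_
    simp only [g]
    gcongr
  · refine NNReal.le_iInf_add_iInf fun δ η => ?_
    -- The majorant with the smaller slope, evaluated at `s + t`, is bounded by the sum of the two.
    rcases le_total δ η with h | h
    · refine (hle (s + t) δ).trans ?_
      have h' : (δ : ℝ≥0) * t ≤ η * t := mul_le_mul_left (α := ℝ≥0) (Subtype.coe_le_coe.2 h) _
      calc c δ + δ * ((s + t : ℕ) : ℝ≥0) = c δ + δ * s + δ * t := by push_cast; ring
        _ ≤ c δ + δ * s + (c η + η * t) := by gcongr; exact h'.trans le_add_self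
    · refine (hle (s + t) η).trans ?_
      have h' : (η : ℝ≥0) * s ≤ δ * s := mul_le_mul_left (α := ℝ≥0) (Subtype.coe_le_coe.2 h) _
      calc c η + η * ((s + t : ℕ) : ℝ≥0) = η * s + (c η + η * t) := by push_cast; ring
        _ ≤ c δ + δ * s + (c η + η * t) := by gcongr; exact h'.trans le_add_self
  · exact le_ciInf fun δ => hc δ t
  · exact ⟨c ⟨δ, hδ⟩, fun t => hle t ⟨δ, hδ⟩⟩

/-! ### Integrability through subadditivity -/

section Integrability

variable {ψ : ℕ → ℝ≥0}

theorem lintegral_add_lt_top (hψ : ∀ s t, ψ (s + t) ≤ ψ s + ψ t) {f g : X → ℕ}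
    (hf : Measurable f) (hfi : ∫⁻ x, ψ (f x) ∂μ < ∞) (hgi : ∫⁻ x, ψ (g x) ∂μ < ∞) :
    ∫⁻ x, ψ (f x + g x) ∂μ < ∞ := by
  have hψf : Measurable fun x => (ψ (f x) : ℝ≥0∞) :=
    (measurable_from_top (f := fun t : ℕ => (ψ t : ℝ≥0∞))).comp hf
  calc ∫⁻ x, ψ (f x + g x) ∂μ ≤ ∫⁻ x, ((ψ (f x) : ℝ≥0∞) + ψ (g x)) ∂μ :=
        lintegral_mono fun x =>
          (ENNReal.coe_le_coe.2 (hψ (f x) (g x))).trans_eq (ENNReal.coe_add _ _)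
    _ = ∫⁻ x, ψ (f x) ∂μ + ∫⁻ x, ψ (g x) ∂μ := lintegral_add_left hψf _
    _ < ∞ := ENNReal.add_lt_top.2 ⟨hfi, hgi⟩

theorem lintegral_const_lt_top [IsFiniteMeasure μ] (m : ℕ) : ∫⁻ _, ψ m ∂μ < ∞ := by
  rw [lintegral_const]
  exact ENNReal.mul_lt_top ENNReal.coe_lt_top (measure_lt_top _ _)

theorem lintegral_sum_lt_top [IsFiniteMeasure μ] (hψ : ∀ s t, ψ (s + t) ≤ ψ s + ψ t) {n : ℕ}
    {f : ℕ → X → ℕ} (hf : ∀ i, Measurable (f i)) (hfi : ∀ i, ∫⁻ x, ψ (f i x) ∂μ < ∞) :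
    ∫⁻ x, ψ (∑ i ∈ Finset.range n, f i x) ∂μ < ∞ := by
  induction n with
  | zero => exact lintegral_const_lt_top 0
  | succ n ih =>
    simp_rw [Finset.sum_range_succ]
    exact lintegral_add_lt_top hψ (Finset.measurable_sum _ fun i _ => hf i) ih (hfi n)

theorem lintegral_comp_aut_lt_top (S : Aut μ) {f : X → ℕ} (hfi : ∫⁻ x, ψ (f x) ∂μ < ∞) :
    ∫⁻ x, ψ (f (S x)) ∂μ < ∞ := by
  rwa [(measurePreserving_coe S).lintegral_comp_emb (measurableEmbedding_coe S)
    fun x => (ψ (f x) : ℝ≥0∞)]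

theorem lintegral_lt_top_of_lintegral_natCast [IsFiniteMeasure μ]
    (hψ : ∀ δ : ℝ≥0, 0 < δ → ∃ c : ℝ≥0, ∀ t, ψ t ≤ c + δ * t) {f : X → ℕ}
    (hf : Measurable f) (hfi : ∫⁻ x, (f x : ℝ≥0∞) ∂μ < ∞) : ∫⁻ x, ψ (f x) ∂μ < ∞ := by
  obtain ⟨c, hc⟩ := hψ 1 one_pos
  have := setLIntegral_le_of_le_add_mul (μ := μ) hc hf MeasurableSet.univ
    (Set.eqOn_refl f Set.univ)
  rw [Measure.restrict_univ] at this
  refine this.trans_lt (ENNReal.add_lt_top.2 ⟨?_, ?_⟩)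
  · exact ENNReal.mul_lt_top ENNReal.coe_lt_top (measure_lt_top _ _)
  · exact ENNReal.mul_lt_top ENNReal.coe_lt_top hfi

theorem hasPhiIntegrableCocycle_of_bound [StandardBorelSpace X] {φ : ℝ≥0 → ℝ≥0} {T U : Aut μ}
    (hmono : Monotone ψ) (hφψ : ∀ t : ℕ, φ t ≤ ψ t) {f : X → ℕ} (hf : ∫⁻ x, ψ (f x) ∂μ < ∞)
    (h : ∀ᵐ x ∂μ, ∃ k : ℤ, k.natAbs ≤ f x ∧ U x = (T ^ k) x) :
    HasPhiIntegrableCocycle φ T U := by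
  obtain ⟨c, hc, hck⟩ := exists_isCocycle T U (h.mono fun x ⟨k, hk⟩ => ⟨k, hk.2⟩)
  refine ⟨c, hc, lt_of_le_of_lt (lintegral_mono_ae ?_) hf⟩
  filter_upwards [h] with x ⟨k, hk, hkx⟩
  exact_mod_cast (hφψ _).trans (hmono ((hck x k hkx).trans hk))

end Integrability

/-! ### Ergodicity under full groups and flip-conjugacy -/

/-- A `U`-invariant set is `T`-invariant up to a null set, since `T` moves points inside `U`-orbits.
-/
theorem ergodic_of_memFullGroup {T U : Aut μ} (hT : Ergodic T μ) (h : MemFullGroup U T) :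
    Ergodic U μ := by
  refine ⟨measurePreserving_coe U, ⟨fun s hs hUs => ?_⟩⟩
  have hU : ∀ x, U x ∈ s ↔ x ∈ s := fun x => Set.ext_iff.1 hUs x
  have hUk : ∀ (k : ℤ) x, (U ^ k) x ∈ s ↔ x ∈ s := by
    intro k x
    induction k with
    | zero => simp
    | succ k ih =>
      rw [add_comm, zpow_add_apply, zpow_one, hU, ih]
    | pred k ih =>
      rw [← ih, ← hU ((U ^ (-k - 1 : ℤ)) x), show (-k : ℤ) = 1 + (-k - 1) by ring, zpow_add_apply,
        zpow_one]
      simp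
  refine hT.quasiErgodic.aeconst_set₀ hs.nullMeasurableSet ?_
  filter_upwards [h] with x ⟨k, hk⟩
  have : T x ∈ s ↔ x ∈ s := by rw [hk, hUk]
  exact propext this

theorem ae_pow_eq {T U : Aut μ} (h : ∀ᵐ x ∂μ, T x = U x) (n : ℕ) :
    ∀ᵐ x ∂μ, (T ^ n) x = (U ^ n) x := by
  induction n with
  | zero => simp
  | succ n ih =>
    filter_upwards [ih, (measurePreserving_coe (T ^ n)).quasiMeasurePreserving.ae h] with x h₁ h₂
    rw [pow_succ', pow_succ']
    change T ((T ^ n) x) = U ((U ^ n) x)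
    rw [h₂, h₁]

theorem Conjugate.ergodic_pow {T U : Aut μ} (h : Conjugate T U) {n : ℕ}
    (hT : Ergodic ((T ^ n : Aut μ) : X → X) μ) : Ergodic ((U ^ n : Aut μ) : X → X) μ := by
  obtain ⟨S, hS⟩ := h
  have h₁ : Ergodic ((S * T ^ n * S⁻¹ : Aut μ) : X → X) μ :=
    (MeasurePreserving.ergodic_conjugate_iff (e := toMeasurableEquiv S)
      (measurePreserving_coe S)).2 hT
  refine ergodic_of_memFullGroup h₁ ?_
  filter_upwards [ae_pow_eq hS n] with x hx
  refine ⟨1, ?_⟩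
  rw [zpow_one, ← hx, conj_pow]

theorem FlipConjugate.ergodic_pow {T U : Aut μ} (h : FlipConjugate T U) {n : ℕ}
    (hT : Ergodic ((T ^ n : Aut μ) : X → X) μ) : Ergodic ((U ^ n : Aut μ) : X → X) μ := by
  rcases h with h | h
  · exact h.ergodic_pow hT
  · refine h.ergodic_pow (ergodic_of_memFullGroup hT (Eventually.of_forall fun x => ⟨-1, ?_⟩))
    simp

/-! ### Cyclic permutations and the transformation `T_D P` -/

section

variable {Y : Type*} {D : Set Y} {n : ℕ} [NeZero n] {Φ : D × Fin n → Y}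

/-- The permutation of `Y` which permutes cyclically the points `Φ (x, 0), …, Φ (x, n - 1)`. -/
noncomputable def cyclePerm (Φ : D × Fin n → Y) (hΦ : Function.Injective Φ) : Equiv.Perm Y :=
  Equiv.Perm.viaEmbedding (Equiv.prodCongr (Equiv.refl D) (Equiv.addRight (1 : Fin n))) ⟨Φ, hΦ⟩

theorem cyclePerm_apply (hΦ : Function.Injective Φ) (x : D) (i : Fin n) :
    cyclePerm Φ hΦ (Φ (x, i)) = Φ (x, i + 1) :=
  Equiv.Perm.viaEmbedding_apply _ (⟨Φ, hΦ⟩ : D × Fin n ↪ Y) (x, i)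

theorem cyclePerm_of_notMem (hΦ : Function.Injective Φ) {y : Y} (hy : y ∉ Set.range Φ) :
    cyclePerm Φ hΦ y = y :=
  Equiv.Perm.viaEmbedding_apply_of_notMem _ (⟨Φ, hΦ⟩ : D × Fin n ↪ Y) y hy

end

theorem cyclePerm_mem_aut {D : Set X} {n : ℕ} [NeZero n] {Φ : D × Fin n → X}
    [StandardBorelSpace X] (hD : MeasurableSet D)
    (hΦ : Function.Injective Φ) (hm : Measurable Φ) {T : Aut μ}
    (hT : ∀ x i, ∃ k : ℤ, cyclePerm Φ hΦ (Φ (x, i)) = (T ^ k) (Φ (x, i))) :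
    cyclePerm Φ hΦ ∈ Aut μ := by
  have : StandardBorelSpace D := hD.standardBorel
  have hemb : MeasurableEmbedding Φ := hm.measurableEmbedding hΦ
  refine mem_aut_of_forall_zpow T _ (fun E hE => ?_) fun y => ?_
  · have hshift : Measurable fun p : D × Fin n => Φ (p.1, p.2 + 1) :=
      hm.comp (measurable_fst.prodMk 
        ((measurable_from_top (f := fun i : Fin n => i + 1)).comp measurable_snd))
    have : cyclePerm Φ hΦ ⁻¹' E =
        Φ '' ((fun p : D × Fin n => Φ (p.1, p.2 + 1)) ⁻¹' E) ∪ (Set.range Φ)ᶜ ∩ E := by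
      ext y
      by_cases hy : y ∈ Set.range Φ
      · obtain ⟨⟨x, i⟩, rfl⟩ := hy
        simp [cyclePerm_apply, hΦ.mem_set_image]
      · simp only [Set.mem_preimage, cyclePerm_of_notMem hΦ hy, Set.mem_union, Set.mem_inter_iff,
          Set.mem_compl_iff, hy, not_false_eq_true, true_and]
        exact ⟨Or.inr, fun h => h.resolve_left fun h => hy (Set.image_subset_range _ _ h)⟩
    rw [this]
    exact (hemb.measurableSet_image.2 (hshift hE)).union (hemb.measurableSet_range.compl.inter hE)
  · by_cases hy : y ∈ Set.range Φ
    · obtain ⟨⟨x, i⟩, rfl⟩ := hy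
      exact hT x i
    · exact ⟨0, by rw [cyclePerm_of_notMem hΦ hy]; simp⟩

/-- The transformation `P` permutes cyclically the points `Φ (x, 0), …, Φ (x, n - 1)`, among which
only `Φ (x, 0) = x` belongs to `D`. -/
structure IsCycleOn (P : Aut μ) (D : Set X) {n : ℕ} [NeZero n] (Φ : D × Fin n → X) : Prop where
  injective : Function.Injective Φ
  apply_zero : ∀ x : D, Φ (x, 0) = x
  ae_mem_range : ∀ᵐ y ∂μ, y ∈ Set.range Φ
  apply : ∀ x i, P (Φ (x, i)) = Φ (x, i + 1)

namespace IsCycleOn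

variable {P : Aut μ} {D : Set X} {n : ℕ} [NeZero n] {Φ : D × Fin n → X}

theorem eq_zero_of_mem (h : IsCycleOn P D Φ) {x : D} {i : Fin n} (hx : Φ (x, i) ∈ D) : i = 0 :=
  (Prod.ext_iff.1 (h.injective (h.apply_zero ⟨_, hx⟩))).2.symm

theorem fin_mk_add_one {m : ℕ} (hm : m + 1 < n) :
    (⟨m, by omega⟩ : Fin n) + 1 = ⟨m + 1, hm⟩ := by
  ext
  rw [Fin.val_add, Fin.val_one', Nat.mod_eq_of_lt (by omega : 1 < n), Nat.mod_eq_of_lt hm]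

theorem fin_mk_last_add_one : (⟨n - 1, Nat.sub_lt (NeZero.pos n) one_pos⟩ : Fin n) + 1 = 0 := by
  ext
  have := NeZero.pos n
  rw [Fin.val_add, Fin.val_one', Nat.add_mod_mod]
  simp [show n - 1 + 1 = n by omega]

theorem pow_apply (h : IsCycleOn P D Φ) (x : D) {m : ℕ} (hm : m < n) :
    (P ^ m) (x : X) = Φ (x, ⟨m, hm⟩) := by
  induction m with
  | zero => exact (h.apply_zero x).symm
  | succ m ih =>
    rw [pow_succ']
    change P ((P ^ m) (x : X)) = _
    rw [ih (by omega), h.apply, fin_mk_add_one hm]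

theorem pow_card_apply (h : IsCycleOn P D Φ) (x : D) : (P ^ n) (x : X) = x := by
  obtain ⟨m, rfl⟩ : ∃ m, n = m + 1 := ⟨n - 1, by have := NeZero.pos n; omega⟩
  rw [pow_succ']
  change P ((P ^ m) (x : X)) = _
  rw [h.pow_apply x (Nat.lt_succ_self m), h.apply, ← h.apply_zero x]
  congr 2
  exact fin_mk_last_add_one

theorem exists_pow_apply_eq (h : IsCycleOn P D Φ) (x : D) (i : Fin n) :
    ∃ m < n, (P ^ m) (Φ (x, i)) = x := by
  rcases Nat.eq_zero_or_pos (i : ℕ) with hi | hi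
  · refine ⟨0, NeZero.pos n, ?_⟩
    rw [show i = 0 from Fin.ext hi, h.apply_zero]; simp
  · refine ⟨n - i, by omega, ?_⟩
    rw [← Fin.eta i i.2, ← h.pow_apply x i.2]
    change (P ^ (n - i) * P ^ (i : ℕ) : Aut μ) (x : X) = x
    rw [← pow_add, Nat.sub_add_cancel i.2.le, h.pow_card_apply]

theorem orbit_eq (h : IsCycleOn P D Φ) (x : D) (i : Fin n) :
    orbit P (Φ (x, i)) = Set.range fun j => Φ (x, j) := by
  refine Set.Subset.antisymm ?_ ?_
  · rintro _ ⟨k, rfl⟩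
    induction k with
    | zero => exact ⟨i, by simp⟩
    | succ k ih =>
      obtain ⟨j, hj⟩ := ih
      refine ⟨j + 1, ?_⟩
      dsimp only at hj ⊢
      rw [add_comm (k : ℤ), zpow_add_apply, zpow_one, ← hj, h.apply]
    | pred k ih =>
      obtain ⟨j, hj⟩ := ih
      refine ⟨j - 1, injective_coe P ?_⟩
      dsimp only at hj ⊢
      rw [h.apply, sub_add_cancel, hj, show (-k : ℤ) = 1 + (-k - 1) by ring, zpow_add_apply,
        zpow_one]
      simp
  · rintro _ ⟨j, rfl⟩
    obtain ⟨m, -, hm⟩ := h.exists_pow_apply_eq x i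
    refine ⟨(j : ℕ) + m, ?_⟩
    dsimp only
    rw [zpow_add_apply, zpow_natCast_apply, zpow_natCast_apply, hm, h.pow_apply x j.2]

theorem isNCycle (h : IsCycleOn P D Φ) : IsNCycle n P := by
  constructor
  · filter_upwards [h.ae_mem_range]
    rintro _ ⟨⟨x, i⟩, rfl⟩
    rw [h.orbit_eq]
    exact Set.finite_range _
  · filter_upwards [h.ae_mem_range]
    rintro _ ⟨⟨x, i⟩, rfl⟩
    right
    rw [h.orbit_eq, ← Set.image_univ, Set.ncard_image_of_injective _
      fun j j' hj => (Prod.ext_iff.1 (h.injective hj)).2]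
    simp [Set.ncard_univ]

theorem hasFullSupport (h : IsCycleOn P D Φ) (hn : 2 ≤ n) : HasFullSupport P := by
  have : Nontrivial (Fin n) := Fin.nontrivial_iff_two_le.2 hn
  filter_upwards [h.ae_mem_range]
  rintro _ ⟨⟨x, i⟩, rfl⟩ heq
  rw [h.apply] at heq
  have := (Prod.ext_iff.1 (h.injective heq)).2
  simp at this
  omega

theorem isFundamentalDomain (h : IsCycleOn P D Φ) (hD : MeasurableSet D) :
    IsFundamentalDomain P D := by
  refine ⟨hD, ?_⟩
  filter_upwards [h.ae_mem_range]
  rintro _ ⟨⟨x, i⟩, rfl⟩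
  rw [h.orbit_eq]
  refine ⟨x, ⟨⟨0, h.apply_zero x⟩, x.2⟩, ?_⟩
  rintro _ ⟨⟨j, rfl⟩, hj⟩
  dsimp only at hj ⊢
  rw [h.eq_zero_of_mem hj, h.apply_zero]

theorem measure_ne_zero [IsProbabilityMeasure μ] (h : IsCycleOn P D Φ) : μ D ≠ 0 := by
  intro h0
  have hD : ∀ᵐ y ∂μ, y ∉ D := measure_eq_zero_iff_ae_notMem.1 h0
  obtain ⟨_, ⟨⟨x, i⟩, rfl⟩, hy⟩ := (h.ae_mem_range.and (ae_forall_zpow P hD)).exists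
  obtain ⟨m, -, hm⟩ := h.exists_pow_apply_eq x i
  refine hy m ?_
  rw [zpow_natCast_apply, hm]
  exact x.2

/-- If `D` were conull, some whole `P`-cycle would lie in `D`, although only its first point does.
-/
theorem not_ae_mem [IsProbabilityMeasure μ] (h : IsCycleOn P D Φ) (hn : 2 ≤ n) :
    ¬ ∀ᵐ y ∂μ, y ∈ D := by
  have : Nontrivial (Fin n) := Fin.nontrivial_iff_two_le.2 hn
  intro hD
  obtain ⟨_, ⟨⟨x, i⟩, rfl⟩, hy⟩ := (h.ae_mem_range.and (ae_forall_zpow P hD)).exists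
  have h₁ := h.eq_zero_of_mem (by simpa using hy 0 : Φ (x, i) ∈ D)
  have h₂ := hy 1
  rw [zpow_one, h.apply] at h₂
  have h₃ := h.eq_zero_of_mem h₂
  rw [h₁] at h₃
  simp at h₃
  omega

variable [StandardBorelSpace X] {T : Aut μ} {hD : MeasurableSet D}

/-- Before the cycle closes, `P` lands off `D`, where the induced map is the identity. -/
theorem induced_mul_pow_apply (h : IsCycleOn P D Φ) (x : D) {m : ℕ} (hm : m < n) :
    ((induced T hD * P) ^ m) (x : X) = Φ (x, ⟨m, hm⟩) := by
  induction m with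
  | zero => exact (h.apply_zero x).symm
  | succ m ih =>
    rw [pow_succ']
    change induced T hD (P (((induced T hD * P) ^ m) (x : X))) = _
    rw [ih (by omega), h.apply, fin_mk_add_one hm]
    refine induced_of_notMem fun hmem => ?_
    have := Fin.ext_iff.1 (h.eq_zero_of_mem hmem)
    simp at this

theorem induced_mul_pow_card_apply (h : IsCycleOn P D Φ) {x : X} (hx : x ∈ D) :
    ((induced T hD * P) ^ n) x = induced T hD x := by
  obtain ⟨m, rfl⟩ : ∃ m, n = m + 1 := ⟨n - 1, by have := NeZero.pos n; omega⟩
  rw [pow_succ']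
  change induced T hD (P (((induced T hD * P) ^ m) x)) = _
  rw [h.induced_mul_pow_apply ⟨x, hx⟩ (Nat.lt_succ_self m), h.apply]
  congr 1
  refine Eq.trans ?_ (h.apply_zero ⟨x, hx⟩)
  congr 2
  exact fin_mk_last_add_one

theorem induced_mul_zpow_apply (h : IsCycleOn P D Φ) {x : X} (hx : x ∈ D) (k : ℤ) :
    (induced T hD ^ k) x ∈ D ∧
      ((induced T hD * P) ^ (n * k : ℤ)) x = (induced T hD ^ k) x := by
  induction k with
  | zero => simpa using hx
  | succ k ih =>
    rw [add_comm (k : ℤ), zpow_add_apply, zpow_one, mul_add, mul_one, zpow_add_apply, ih.2,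
      zpow_natCast_apply _ n, h.induced_mul_pow_card_apply ih.1]
    exact ⟨induced_mem ih.1, rfl⟩
  | pred k ih =>
    have h₁ : induced T hD ((induced T hD ^ (-k - 1 : ℤ)) x) = (induced T hD ^ (-k : ℤ)) x := by
      rw [show (-k : ℤ) = 1 + (-k - 1) by ring, zpow_add_apply, zpow_one]
      simp
    have h₂ : (induced T hD ^ (-k - 1 : ℤ)) x ∈ D := by
      rw [← induced_mem_iff (hA := hD), h₁]
      exact ih.1
    refine ⟨h₂, injective_coe ((induced T hD * P) ^ n) ?_⟩
    rw [h.induced_mul_pow_card_apply h₂, h₁, ← ih.2, ← zpow_natCast_apply, ← zpow_add_apply]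
    congr 3; ring

theorem not_ergodic_pow [IsProbabilityMeasure μ] (h : IsCycleOn P D Φ) (hn : 2 ≤ n)
    (hD : MeasurableSet D) :
    ¬ Ergodic (((induced T hD * P) ^ n : Aut μ) : X → X) μ := fun herg =>
  h.not_ae_mem hn (ae_mem_of_measurableSet_invariant herg hD
    (fun x hx => by rw [h.induced_mul_pow_card_apply hx]; exact induced_mem hx) h.measure_ne_zero)

end IsCycleOn

/-! ### The cycle and the orbit equivalence -/

theorem exists_isCycleOn [StandardBorelSpace X] [IsProbabilityMeasure μ] [NullSingletonClass μ]
    {T : Aut μ} (hT : Ergodic T μ) {ψ : ℕ → ℝ≥0}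
    (hψ : ∀ δ : ℝ≥0, 0 < δ → ∃ c : ℝ≥0, ∀ t, ψ t ≤ c + δ * t)
    (hψ' : ∀ s t, ψ (s + t) ≤ ψ s + ψ t) (n : ℕ) [NeZero n] :
    ∃ (P : Aut μ) (D : Set X) (Φ : D × Fin n → X) (ℓ : X → ℕ), MeasurableSet D ∧
      IsCycleOn P D Φ ∧ Measurable ℓ ∧ ∫⁻ x, ψ (ℓ x) ∂μ < ∞ ∧
      ∀ x i, ∃ m ≤ ℓ (Φ (x, i)), Φ (x, i) = (T ^ m) x ∧
        ∃ m' ≤ ℓ (Φ (x, i)), Φ (x, i + 1) = (T ^ m') x := by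
  obtain ⟨D, Φ, ρ, hD, hΦm, hΦ, hΦ0, hran, hρ, hρm, hint⟩ := exists_orbit_partition hT hψ n
  have hP : cyclePerm Φ hΦ ∈ Aut μ := by
    refine cyclePerm_mem_aut hD hΦ hΦm (T := T) fun x i => ?_
    obtain ⟨m, -, hm⟩ := hρm x i
    obtain ⟨m', -, hm'⟩ := hρm x (i + 1)
    refine ⟨m' + -m, ?_⟩
    rw [cyclePerm_apply, hm, hm', zpow_add_apply, ← zpow_natCast_apply, ← zpow_natCast_apply,
      zpow_neg_apply_zpow]
  let P : Aut μ := ⟨cyclePerm Φ hΦ, hP⟩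
  have hc : IsCycleOn P D Φ := ⟨hΦ, hΦ0, hran, cyclePerm_apply hΦ⟩
  -- The bound `ρ` is attached to base points; summing it along the cycle makes it available at
  -- every point while keeping `ψ` of it integrable.
  refine ⟨P, D, Φ, fun y => ∑ i ∈ Finset.range n, ρ ((P ^ i) y), hD, hc,
    Finset.measurable_sum _ fun i _ => hρ.comp (measurable_coe _),
    lintegral_sum_lt_top hψ' (fun i => hρ.comp (measurable_coe _))
      (fun i => lintegral_comp_aut_lt_top _ hint), fun x i => ?_⟩
  have hle : ρ x ≤ ∑ j ∈ Finset.range n, ρ ((P ^ j) (Φ (x, i))) := by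
    obtain ⟨m, hm, hmx⟩ := hc.exists_pow_apply_eq x i
    conv_lhs => rw [← hmx]
    exact Finset.single_le_sum (f := fun j => ρ ((P ^ j) (Φ (x, i)))) (fun _ _ => Nat.zero_le _)
      (Finset.mem_range.2 hm)
  obtain ⟨m, hm, hmx⟩ := hρm x i
  obtain ⟨m', hm', hmx'⟩ := hρm x (i + 1)
  exact ⟨m, hm.trans hle, hmx, m', hm'.trans hle, hmx'⟩

/-- For a suitable `n`-cycle `P` in the full group of `T` and a fundamental domain `D` of `P`, the
transformation `U = T_D P` is `φ`-integrable orbit equivalent to `T` and `U ^ n` preserves `D`. -/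
theorem exists_cycle_phiIntegrableOE [StandardBorelSpace X] [IsProbabilityMeasure μ]
    [NullSingletonClass μ] {φ : ℝ≥0 → ℝ≥0} (hφ : Sublinear φ) {T : Aut μ} (hT : Ergodic T μ)
    {n : ℕ} (hn : 2 ≤ n) :
    ∃ (P U : Aut μ) (D : Set X), IsNCycle n P ∧ HasFullSupport P ∧ MemFullGroup T P ∧
      HasPhiIntegrableCocycle φ T P ∧ IsFundamentalDomain P D ∧
      (∀ᵐ x ∂μ, U x = firstReturn T D (P x)) ∧ SameOrbits T U ∧
      PhiIntegrableOE φ T U ∧ ¬ Ergodic ((U ^ n : Aut μ) : X → X) μ := by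
  have : NeZero n := ⟨by omega⟩
  obtain ⟨ψ, hmono, hsub, hφψ, hψ⟩ := hφ.exists_subadditive
  obtain ⟨P, D, Φ, ℓ, hD, hc, hℓ, hℓi, hΦ⟩ := exists_isCycleOn hT hψ hsub n
  let U : Aut μ := induced T hD * P
  have hPT : ∀ᵐ y ∂μ, ∃ k : ℤ, k.natAbs ≤ ℓ y ∧ P y = (T ^ k) y := by
    filter_upwards [hc.ae_mem_range]
    rintro _ ⟨⟨x, i⟩, rfl⟩
    obtain ⟨m, hm, hmx, m', hm', hmx'⟩ := hΦ x i
    -- Both `m` and `m'` lie between `0` and `ℓ`, so their difference is at most `ℓ` in absolute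
    -- value.
    refine ⟨m' + -m, by omega, ?_⟩
    rw [hc.apply, hmx', zpow_add_apply, hmx, ← zpow_natCast_apply, ← zpow_natCast_apply,
      zpow_neg_apply_zpow]
  have hUT : ∀ᵐ y ∂μ, ∃ k : ℤ, k.natAbs ≤ ℓ y + inducedTime T D (P y) ∧ U y = (T ^ k) y := by
    filter_upwards [hPT] with y ⟨k, hk, hky⟩
    refine ⟨inducedTime T D (P y) + k, by omega, ?_⟩
    rw [zpow_add_apply, ← hky, zpow_natCast_apply]
    rfl
  -- The product by `n` is written as a sum so that subadditivity applies termwise.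
  have hTU : ∀ᵐ y ∂μ, ∃ k : ℤ, k.natAbs ≤ n + ∑ _j ∈ Finset.range n, (ℓ y + ℓ (T y) + 1) ∧
      T y = (U ^ k) y := by
    filter_upwards [hc.ae_mem_range, ae_forall_zpow T hc.ae_mem_range,
      ae_forall_zpow T (ae_mem_recurrentPart T hD)]
    rintro _ ⟨⟨a, i⟩, rfl⟩ hran hrec
    obtain ⟨⟨b, j⟩, hb⟩ := hran 1
    rw [zpow_one] at hb
    obtain ⟨m, hm, hma, -⟩ := hΦ a i
    obtain ⟨m', hm', hmb, -⟩ := hΦ b j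
    rw [← hb]
    have ha : (a : X) = (T ^ (-m : ℤ)) (Φ (a, i)) := by
      rw [hma, ← zpow_natCast_apply, zpow_neg_apply_zpow]
    have harec : (a : X) ∈ recurrentPart T D := by
      rw [ha]
      exact hrec (-m) (by rw [← ha]; exact a.2)
    have hba : (T ^ (-m' + 1 + m : ℤ)) (a : X) = b := by
      rw [zpow_add_apply, zpow_natCast_apply, ← hma, zpow_add_apply, zpow_one, ← hb, hmb,
        ← zpow_natCast_apply, zpow_neg_apply_zpow]
    obtain ⟨k, hk, hkab⟩ := exists_induced_zpow_eq (hA := hD) harec (m := -m' + 1 + m)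
      (by rw [hba]; exact b.2)
    rw [hba] at hkab
    -- Descend `i` levels to `a`, pass from `a` to `b` by `T_D ^ k = U ^ (n * k)`, then climb `j`
    -- levels.
    refine ⟨(j : ℕ) + n * k + -(i : ℕ), ?_, ?_⟩
    · have hkn : (n * k : ℤ).natAbs ≤ n * (ℓ (Φ (a, i)) + ℓ (Φ (b, j)) + 1) := by
        rw [Int.natAbs_mul, Int.natAbs_natCast]
        exact Nat.mul_le_mul_left n (by omega)
      rw [Finset.sum_const, Finset.card_range, smul_eq_mul]
      have hi := i.2
      have hj := j.2
      omega
    · have hia : (U ^ (-(i : ℕ) : ℤ)) (Φ (a, i)) = a := by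
        rw [← Fin.eta i i.2, ← hc.induced_mul_pow_apply (T := T) (hD := hD) a i.2,
          ← zpow_natCast_apply]
        exact zpow_neg_apply_zpow _ _ _
      rw [zpow_add_apply, zpow_add_apply, hia, (hc.induced_mul_zpow_apply a.2 k).2, hkab,
        zpow_natCast_apply, hc.induced_mul_pow_apply b j.2]
  have hSO : SameOrbits T U := sameOrbits_of_memFullGroup
    (hUT.mono fun y ⟨k, hk⟩ => ⟨k, hk.2⟩) (hTU.mono fun y ⟨k, hk⟩ => ⟨k, hk.2⟩)
  have hreturn : ∫⁻ x, ψ (inducedTime T D x) ∂μ < ∞ :=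
    lintegral_lt_top_of_lintegral_natCast hψ (measurable_inducedTime T hD)
      ((lintegral_inducedTime_le T hD).trans_lt (measure_lt_top _ _))
  have hℓT : ∫⁻ y, ψ (ℓ y + ℓ (T y)) ∂μ < ∞ :=
    lintegral_add_lt_top hsub hℓ hℓi (lintegral_comp_aut_lt_top T hℓi)
  have hℓTm : Measurable fun y => ℓ y + ℓ (T y) := hℓ.add (hℓ.comp (measurable_coe T))
  have haper := aperiodic_of_ergodic hT
  refine ⟨P, U, D, hc.isNCycle, hc.hasFullSupport hn, hPT.mono fun y ⟨k, hk⟩ => ⟨k, hk.2⟩,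
    hasPhiIntegrableCocycle_of_bound hmono hφψ hℓi hPT, hc.isFundamentalDomain hD,
    (measurePreserving_coe P).quasiMeasurePreserving.ae (ae_induced_eq_firstReturn T hD), hSO,
    ⟨haper, ?_, 1, ?_⟩, hc.not_ergodic_pow hn hD⟩
  · filter_upwards [haper, hSO] with x h₁ h₂
    rwa [← h₂]
  · rw [one_mul, inv_one, mul_one]
    refine ⟨hSO, hasPhiIntegrableCocycle_of_bound hmono hφψ ?_ hTU,
      hasPhiIntegrableCocycle_of_bound hmono hφψ ?_ hUT⟩
    · exact lintegral_add_lt_top hsub measurable_const (lintegral_const_lt_top n)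
        (lintegral_sum_lt_top hsub (fun _ => hℓTm.add_const 1) fun _ =>
          lintegral_add_lt_top hsub hℓTm hℓT (lintegral_const_lt_top 1))
    · exact lintegral_add_lt_top hsub hℓ hℓi (lintegral_comp_aut_lt_top P hreturn)

end QuantOE

theorem mainTheorem2 {X : Type*} [MeasurableSpace X] [StandardBorelSpace X]
    (μ : Measure X) [IsProbabilityMeasure μ] [NullSingletonClass μ]
    (φ : ℝ≥0 → ℝ≥0) (hφ : QuantOE.Sublinear φ)
    (T : QuantOE.Aut μ) (hT : Ergodic T μ) :
    (∀ n : ℕ, 2 ≤ n → ∃ (P U : QuantOE.Aut μ) (D : Set X),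
      QuantOE.IsNCycle n P ∧ QuantOE.HasFullSupport P ∧ QuantOE.MemFullGroup T P ∧
      QuantOE.HasPhiIntegrableCocycle φ T P ∧
      QuantOE.IsFundamentalDomain P D ∧
      (∀ᵐ x ∂μ, U x = QuantOE.firstReturn T D (P x)) ∧
      QuantOE.PhiIntegrableOE φ T U ∧
      ¬ Ergodic ((U ^ n : QuantOE.Aut μ) : X → X) μ) ∧
    ((∃ n : ℕ, 2 ≤ n ∧ Ergodic ((T ^ n : QuantOE.Aut μ) : X → X) μ) →
      ∃ U : QuantOE.Aut μ, Ergodic U μ ∧ QuantOE.PhiIntegrableOE φ T U ∧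
        ¬ QuantOE.FlipConjugate T U) := by
  refine ⟨fun n hn => ?_, fun ⟨n, hn, hTn⟩ => ?_⟩
  · obtain ⟨P, U, D, h₁, h₂, h₃, h₄, h₅, h₆, -, h₇, h₈⟩ :=
      QuantOE.exists_cycle_phiIntegrableOE hφ hT hn
    exact ⟨P, U, D, h₁, h₂, h₃, h₄, h₅, h₆, h₇, h₈⟩
  -- The same `n` is used: a flip-conjugacy would make `U ^ n` ergodic along with `T ^ n`.
  · obtain ⟨P, U, D, -, -, -, -, -, -, hSO, hOE, hU⟩ :=
      QuantOE.exists_cycle_phiIntegrableOE hφ hT hn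
    refine ⟨U, QuantOE.ergodic_of_memFullGroup hT ?_, hOE, fun h => hU (h.ergodic_pow hTn)⟩
    filter_upwards [hSO] with x hx
    obtain ⟨k, hk⟩ : T x ∈ QuantOE.orbit U x := hx ▸ ⟨1, by simp⟩
    exact ⟨k, hk.symm⟩
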